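/- For a finite group $G$, let the directed power graph $DPow(G)$ be the directed graph with vertex set $G$ in which $(x,y)$ is an edge if and only if $y=x^m$ for some integer $m$. Two directed graphs are isomorphic if there is a bijection between their vertex sets that preserves and reflects edges. **Theorem.** There is a polynomial-time algorithm that, given as input two directed graphs $\Gamma_1,\Gamma_2$ (by their adjacency matrices, with arbitrarily labelled vertices), each of which is isomorphic to the directed power graph of some finite nilpotent group, decides whether $\Gamma_1$ and $\Gamma_2$ are isomorphic. The underlying groups are not part of the input. That is, there are one algorithm (a program for a random access machine with addition, truncated subtraction, indirect addressing and unit cost per step) and one polynomial $p$ such that, on every such input of bit length $N$, the algorithm halts after at most $p(N)$ steps and outputs $1$ if $\Gamma_1\cong\Gamma_2$ and $0$ otherwise. -/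

import Mathlib

/-! ### Directed power graphs -/

/-- The directed power graph `DPow(G)`: vertex set `G`, and `(x, y)` is an edge iff `y = x ^ m`
for some integer `m` (so every vertex carries a self-loop). -/
def directedPowerGraph (G : Type*) [Group G] : Digraph G where
  Adj x y := ∃ m : ℤ, y = x ^ m

/-- Isomorphism of directed graphs: a bijection of the vertices that preserves and reflects
edges. -/
def Digraph.Isomorphic {V W : Type*} (X : Digraph V) (Y : Digraph W) : Prop :=
  Nonempty (X.Adj ≃r Y.Adj)

/-- A digraph on the vertices `0, …, n - 1` is (an arbitrarily labelled copy of) the directed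
power graph of some finite nilpotent group. The group is not part of the data. -/
def IsNilpotentDPow {n : ℕ} (X : Digraph (Fin n)) : Prop :=
  ∃ (G : Type) (_ : Group G),
    Finite G ∧ Group.IsNilpotent G ∧ X.Isomorphic (directedPowerGraph G)

/-! ### Encoding of digraphs as bit strings -/

open Classical in
/-- A digraph on `n` vertices as the bit string `1ⁿ 0` followed by the `n²` entries of its
adjacency matrix, row by row. -/
noncomputable def Digraph.encode {n : ℕ} (X : Digraph (Fin n)) : List Bool :=
  List.replicate n true ++ false ::
    (List.finRange n).flatMap fun u => (List.finRange n).map fun v => decide (X.Adj u v)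

/-! ### Random access machines

The unit-cost random access machine: registers and memory cells hold natural numbers; the
arithmetic instructions are addition and truncated subtraction only (no multiplication, no shifts,
so that numbers get longer by at most one bit per step and polynomial time is the usual class);
memory is accessed by indirect addressing. Programs are finite and structured by `if` and
`while`. -/

namespace RAM

/-- Programs. The arguments of the instructions are indices of registers, except for the second
argument of `const`, which is a number. -/
inductive Prog : Type
  /-- `r_i := c` -/
  | const (i c : ℕ) : Prog
  /-- `r_i := r_j + r_k` -/
  | add (i j k : ℕ) : Prog
  /-- `r_i := r_j - r_k`, which is `0` if `r_j < r_k` -/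
  | sub (i j k : ℕ) : Prog
  /-- `r_i := mem[r_j]` -/
  | load (i j : ℕ) : Prog
  /-- `mem[r_i] := r_j` -/
  | store (i j : ℕ) : Prog
  /-- first `P`, then `Q` -/
  | seq (P Q : Prog) : Prog
  /-- if `r_i ≠ 0` then `P` else `Q` -/
  | ite (i : ℕ) (P Q : Prog) : Prog
  /-- while `r_i ≠ 0` do `P` -/
  | while (i : ℕ) (P : Prog) : Prog

/-- A state of the machine: the contents of the registers and of the memory cells. -/
structure State : Type where
  reg : ℕ → ℕ
  mem : ℕ → ℕ

/-- The state `s` with register `i` set to `x`. -/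
def State.setReg (s : State) (i x : ℕ) : State :=
  { s with reg := Function.update s.reg i x }

/-- The state `s` with memory cell `a` set to `x`. -/
def State.setMem (s : State) (a x : ℕ) : State :=
  { s with mem := Function.update s.mem a x }

/-- `Exec P s t s'`: started in the state `s`, the program `P` halts in the state `s'` after
exactly `t` steps. Every instruction and every evaluation of a test is one step. -/
inductive Exec : Prog → State → ℕ → State → Prop
  | const (i c : ℕ) (s : State) : Exec (.const i c) s 1 (s.setReg i c)
  | add (i j k : ℕ) (s : State) : Exec (.add i j k) s 1 (s.setReg i (s.reg j + s.reg k))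
  | sub (i j k : ℕ) (s : State) : Exec (.sub i j k) s 1 (s.setReg i (s.reg j - s.reg k))
  | load (i j : ℕ) (s : State) : Exec (.load i j) s 1 (s.setReg i (s.mem (s.reg j)))
  | store (i j : ℕ) (s : State) : Exec (.store i j) s 1 (s.setMem (s.reg i) (s.reg j))
  | seq {P Q : Prog} {s₁ s₂ s₃ : State} {t₁ t₂ : ℕ} :
      Exec P s₁ t₁ s₂ → Exec Q s₂ t₂ s₃ → Exec (.seq P Q) s₁ (t₁ + t₂) s₃
  | ite_true {i : ℕ} {P Q : Prog} {s s' : State} {t : ℕ} :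
      s.reg i ≠ 0 → Exec P s t s' → Exec (.ite i P Q) s (t + 1) s'
  | ite_false {i : ℕ} {P Q : Prog} {s s' : State} {t : ℕ} :
      s.reg i = 0 → Exec Q s t s' → Exec (.ite i P Q) s (t + 1) s'
  | while_done {i : ℕ} {P : Prog} {s : State} :
      s.reg i = 0 → Exec (.while i P) s 1 s
  | while_loop {i : ℕ} {P : Prog} {s₁ s₂ s₃ : State} {t₁ t₂ : ℕ} :
      s₁.reg i ≠ 0 → Exec P s₁ t₁ s₂ → Exec (.while i P) s₂ t₂ s₃ →
        Exec (.while i P) s₁ (t₁ + t₂ + 1) s₃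

/-- The machine is deterministic: the final state and the number of steps are unique. -/
theorem Exec.unique {P : Prog} {s s₁ s₂ : State} {t₁ t₂ : ℕ}
    (h₁ : Exec P s t₁ s₁) (h₂ : Exec P s t₂ s₂) : t₁ = t₂ ∧ s₁ = s₂ := by
  induction h₁ generalizing t₂ s₂ with
  | const | add | sub | load | store => cases h₂; exact ⟨rfl, rfl⟩
  | seq _ _ ih₁ ih₂ =>
    cases h₂ with
    | seq a b =>
      obtain ⟨rfl, rfl⟩ := ih₁ a
      obtain ⟨rfl, rfl⟩ := ih₂ b
      exact ⟨rfl, rfl⟩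
  | ite_true h _ ih =>
    cases h₂ with
    | ite_true _ a => obtain ⟨rfl, rfl⟩ := ih a; exact ⟨rfl, rfl⟩
    | ite_false h' _ => exact absurd h' h
  | ite_false h _ ih =>
    cases h₂ with
    | ite_true h' _ => exact absurd h h'
    | ite_false _ a => obtain ⟨rfl, rfl⟩ := ih a; exact ⟨rfl, rfl⟩
  | while_done h =>
    cases h₂ with
    | while_done => exact ⟨rfl, rfl⟩
    | while_loop h' => exact absurd h h'
  | while_loop h _ _ ih₁ ih₂ =>
    cases h₂ with
    | while_done h' => exact absurd h' h
    | while_loop _ a b =>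
      obtain ⟨rfl, rfl⟩ := ih₁ a
      obtain ⟨rfl, rfl⟩ := ih₂ b
      exact ⟨rfl, rfl⟩

/-- The initial state on input `w`: the bits of `w` are in the memory cells `0, …, |w| - 1`, the
length `|w|` is in register `0`, and everything else is `0`. -/
def init (w : List Bool) : State where
  reg i := if i = 0 then w.length else 0
  mem a := (w.getD a false).toNat

/-- On input `w`, the program `P` halts after at most `T` steps with `b` in register `0`. -/
def OutputsWithin (P : Prog) (w : List Bool) (b : Bool) (T : ℕ) : Prop :=
  ∃ (t : ℕ) (s : State), Exec P (init w) t s ∧ t ≤ T ∧ s.reg 0 = b.toNat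

end RAM

/-! The algorithm is colour refinement on the disjoint union of the two digraphs. Vertices are split
by out-degree and by the number of in-neighbours of each colour. After `N` rounds the input is
accepted if every vertex of the first digraph shares its colour with some vertex of the second.

An isomorphism extends to an automorphism of the union that swaps the two halves, and automorphisms
preserve colours (`IsColorRefinement.of_isomorphic`).

For the converse, some round among the first `N` is stable (`IsColorRefinement.exists_stable`). In a
directed power graph the out-degree of `g` is its order and its in-neighbours are its roots, i.e.
the elements having `g` as a power. So in a stable round, equally coloured elements have equal order
and equally many roots of each colour (`IsDPowNumbering.isRootColoring`). This allows a greedy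
construction of an injective, colour- and power-preserving map on the elements of prime power order.
If `y ^ p` is already mapped but `y` is not, the root counts leave an unused root of the image with
the colour of `y` (`IsPartialPowerMap.exists_root`), and the map extends to the cyclic group of `y`.
Nilpotency enters last: each group is the product of its Sylow subgroups, so the map can be applied
componentwise. The result is injective and preserves powers, and since the orders agree it is an
isomorphism of the directed power graphs (`IsRootColoring.directedPowerGraph_isomorphic`).

For the machine, expressions with sums over `0, …, N - 1` compile to programs of polynomial cost
(`RAM.Expr.halts_compile`). A loop over `N ^ 2` memory cells then fills a table whose entries may
refer to earlier ones (`RAM.exists_prog_table`). With one row per round it holds all colours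
(`RAM.isColorRefinement_table`). -/

/-! ### A language of expressions with bounded sums -/

namespace RAM

/-- Expressions over the length `N` of the input, the memory and named variables. The expression
`sum v e` is the sum of the values of `e` with `0, …, N - 1` for the variable `v`. -/
inductive Expr : Type
  | const (c : ℕ) : Expr
  | size : Expr
  | var (i : ℕ) : Expr
  | add (a b : Expr) : Expr
  | sub (a b : Expr) : Expr
  | load (a : Expr) : Expr
  | ite (c a b : Expr) : Expr
  | sum (v : ℕ) (e : Expr) : Expr

namespace Expr

/-- The value of an expression, for the length `N`, the memory `m` and the valuation `ρ`. -/
def eval (N : ℕ) (m : ℕ → ℕ) : Expr → (ℕ → ℕ) → ℕ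
  | const c, _ => c
  | size, _ => N
  | var i, ρ => ρ i
  | add a b, ρ => a.eval N m ρ + b.eval N m ρ
  | sub a b, ρ => a.eval N m ρ - b.eval N m ρ
  | load a, ρ => m (a.eval N m ρ)
  | ite c a b, ρ => if c.eval N m ρ ≠ 0 then a.eval N m ρ else b.eval N m ρ
  | sum v e, ρ => ∑ k ∈ Finset.range N, e.eval N m (Function.update ρ v k)

/-- A strict upper bound of the variables of an expression. -/
def bound : Expr → ℕ
  | const _ => 0
  | size => 0
  | var i => i + 1
  | add a b => max a.bound b.bound
  | sub a b => max a.bound b.bound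
  | load a => a.bound
  | ite c a b => max c.bound (max a.bound b.bound)
  | sum v e => max (v + 1) e.bound

/-- A program that puts the value of an expression into register `d` and uses the registers from
`d` on as scratch space. The length is in register `0`, the variable `i` in register `i + 1`. -/
def compile : Expr → ℕ → Prog
  | const c, d => .const d c
  | size, d => .seq (.const (d + 1) 0) (.add d 0 (d + 1))
  | var i, d => .seq (.const (d + 1) 0) (.add d (i + 1) (d + 1))
  | add a b, d => .seq (a.compile d) (.seq (b.compile (d + 1)) (.add d d (d + 1)))
  | sub a b, d => .seq (a.compile d) (.seq (b.compile (d + 1)) (.sub d d (d + 1)))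
  | load a, d => .seq (a.compile d) (.load d d)
  | ite c a b, d => .seq (c.compile d) (.ite d (a.compile d) (b.compile d))
  -- Register `d` accumulates the sum, `d + 1` saves the outer value of the bound variable, `d + 2`
  -- counts down from the length, and the body works from `d + 3` on.
  | sum v e, d =>
    .seq (.const d 0) (.seq (.add (d + 1) (v + 1) d) (.seq (.add (d + 2) 0 d)
      (.seq (.const (v + 1) 0) (.seq
        (.while (d + 2) (.seq (e.compile (d + 3)) (.seq (.add d d (d + 3)) (.seq (.const (d + 3) 1)
          (.seq (.add (v + 1) (v + 1) (d + 3)) (.sub (d + 2) (d + 2) (d + 3)))))))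
        (.seq (.const (d + 3) 0) (.add (v + 1) (d + 1) (d + 3)))))))

/-- A bound of the time for the evaluation of an expression, in terms of the length. -/
noncomputable def cost : Expr → Polynomial ℕ
  | const _ => 1
  | size => 2
  | var _ => 2
  | add a b => a.cost + (b.cost + 1)
  | sub a b => a.cost + (b.cost + 1)
  | load a => a.cost + 1
  | ite c a b => c.cost + (a.cost + b.cost + 1)
  | sum _ e => Polynomial.X * (e.cost + 5) + 7

end Expr

/-! ### Reasoning about programs -/

/-- From `s`, the program `P` halts after at most `T` steps in a state that satisfies `Q`. -/
def Halts (P : Prog) (s : State) (T : ℕ) (Q : State → Prop) : Prop :=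
  ∃ t s', Exec P s t s' ∧ t ≤ T ∧ Q s'

namespace Halts

variable {P P' : Prog} {s : State} {T T' : ℕ} {Q Q' : State → Prop}

theorem mono (h : Halts P s T Q) (hT : T ≤ T') (hQ : ∀ s', Q s' → Q' s') : Halts P s T' Q' := by
  obtain ⟨t, s', h, ht, hs⟩ := h
  exact ⟨t, s', h, ht.trans hT, hQ _ hs⟩

theorem seq (h : Halts P s T Q) (h' : ∀ s', Q s' → Halts P' s' T' Q') :
    Halts (.seq P P') s (T + T') Q' := by
  obtain ⟨t, s', h, ht, hs⟩ := h
  obtain ⟨t', s'', h', ht', hs'⟩ := h' s' hs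
  exact ⟨_, _, .seq h h', add_le_add ht ht', hs'⟩

theorem const {i c : ℕ} (h : Q (s.setReg i c)) : Halts (.const i c) s 1 Q :=
  ⟨_, _, .const i c s, le_rfl, h⟩

theorem add {i j k : ℕ} (h : Q (s.setReg i (s.reg j + s.reg k))) : Halts (.add i j k) s 1 Q :=
  ⟨_, _, .add i j k s, le_rfl, h⟩

theorem sub {i j k : ℕ} (h : Q (s.setReg i (s.reg j - s.reg k))) : Halts (.sub i j k) s 1 Q :=
  ⟨_, _, .sub i j k s, le_rfl, h⟩

theorem load {i j : ℕ} (h : Q (s.setReg i (s.mem (s.reg j)))) : Halts (.load i j) s 1 Q :=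
  ⟨_, _, .load i j s, le_rfl, h⟩

theorem const_seq {i c : ℕ} (h : Halts P (s.setReg i c) T Q) :
    Halts (.seq (.const i c) P) s (1 + T) Q :=
  seq (Q := (· = s.setReg i c)) (const rfl) fun _ hs => hs ▸ h

theorem add_seq {i j k : ℕ} (h : Halts P (s.setReg i (s.reg j + s.reg k)) T Q) :
    Halts (.seq (.add i j k) P) s (1 + T) Q :=
  seq (Q := (· = s.setReg i (s.reg j + s.reg k))) (add rfl) fun _ hs => hs ▸ h

theorem store_seq {i j : ℕ} (h : Halts P (s.setMem (s.reg i) (s.reg j)) T Q) :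
    Halts (.seq (.store i j) P) s (1 + T) Q :=
  seq (Q := (· = s.setMem (s.reg i) (s.reg j))) ⟨_, _, .store i j s, le_rfl, rfl⟩
    fun _ hs => hs ▸ h

/-- A loop that counts register `c` down. -/
theorem while_countdown {c : ℕ} (I : ℕ → State → Prop)
    (hI : ∀ k s, I (k + 1) s → s.reg c = k + 1 →
      Halts P s T fun s' => I k s' ∧ s'.reg c = k) :
    ∀ k s, I k s → s.reg c = k → Halts (.while c P) s (k * (T + 1) + 1) (I 0)
  | 0, s, h, hc => ⟨1, s, .while_done hc, by simp, h⟩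
  | k + 1, s, h, hc => by
    obtain ⟨t, s', hP, ht, h', hc'⟩ := hI k s h hc
    obtain ⟨t', s'', hW, ht', h''⟩ := while_countdown I hI k s' h' hc'
    exact ⟨_, _, .while_loop (by simp [hc]) hP hW, by linarith, h''⟩

end Halts

namespace Expr

/-- By induction on the expression. Preservation of all registers below `d` lets a subexpression run
at `d + 1` without losing the value in `d`; a sum meets it because it restores its variable at the
end. -/
theorem halts_compile {N D : ℕ} (e : Expr) (he : e.bound ≤ D) (d : ℕ) (hd : D < d) (s : State)
    (ρ : ℕ → ℕ) (hN : s.reg 0 = N) (hρ : ∀ i < D, s.reg (i + 1) = ρ i) :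
    Halts (e.compile d) s (e.cost.eval N) fun s' =>
      s'.mem = s.mem ∧ (∀ i < d, s'.reg i = s.reg i) ∧ s'.reg d = e.eval N s.mem ρ := by
  induction e generalizing d s ρ with
  | const c =>
    refine Halts.mono (Halts.const (Q := fun s' => _) ⟨rfl, fun i hi => ?_, ?_⟩)
      (by simp [cost]) fun _ h => h
    · simp [State.setReg, hi.ne]
    · simp [State.setReg, eval]
  | size =>
    refine Halts.mono (Halts.const_seq (Halts.add (Q := fun s' => _) ⟨rfl, fun i hi => ?_, ?_⟩))
      (by simp [cost]) fun _ h => h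
    · simp [State.setReg, hi.ne, (show i ≠ d + 1 by omega)]
    · simp [State.setReg, eval, hN]
  | var i =>
    simp only [bound] at he
    refine Halts.mono (Halts.const_seq (Halts.add (Q := fun s' => _) ⟨rfl, fun j hi => ?_, ?_⟩))
      (by simp [cost]) fun _ h => h
    · simp [State.setReg, hi.ne, (show j ≠ d + 1 by omega)]
    · simp [State.setReg, eval, hρ i he, (show i ≠ d by omega)]
  | add a b iha ihb =>
    simp only [bound, max_le_iff] at he
    simp only [compile, cost, Polynomial.eval_add, Polynomial.eval_one]
    refine (iha he.1 d hd s ρ hN hρ).seq fun s₁ ⟨hm₁, hr₁, hv₁⟩ => ?_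
    refine (ihb he.2 (d + 1) (by omega) s₁ ρ (by rw [hr₁ 0 (by omega), hN])
      (fun i hi => by rw [hr₁ _ (by omega), hρ i hi])).seq fun s₂ ⟨hm₂, hr₂, hv₂⟩ => ?_
    refine Halts.add ⟨hm₂.trans hm₁, fun i hi => ?_, ?_⟩
    · simp [State.setReg, hi.ne, hr₂ i (by omega), hr₁ i hi]
    · simp [State.setReg, eval, hv₂, hr₂ d (by omega), hv₁, hm₁]
  | sub a b iha ihb =>
    simp only [bound, max_le_iff] at he
    simp only [compile, cost, Polynomial.eval_add, Polynomial.eval_one]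
    refine (iha he.1 d hd s ρ hN hρ).seq fun s₁ ⟨hm₁, hr₁, hv₁⟩ => ?_
    refine (ihb he.2 (d + 1) (by omega) s₁ ρ (by rw [hr₁ 0 (by omega), hN])
      (fun i hi => by rw [hr₁ _ (by omega), hρ i hi])).seq fun s₂ ⟨hm₂, hr₂, hv₂⟩ => ?_
    refine Halts.sub ⟨hm₂.trans hm₁, fun i hi => ?_, ?_⟩
    · simp [State.setReg, hi.ne, hr₂ i (by omega), hr₁ i hi]
    · simp [State.setReg, eval, hv₂, hr₂ d (by omega), hv₁, hm₁]
  | load a iha =>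
    simp only [bound] at he
    simp only [compile, cost, Polynomial.eval_add, Polynomial.eval_one]
    refine (iha he d hd s ρ hN hρ).seq fun s₁ ⟨hm₁, hr₁, hv₁⟩ => ?_
    refine Halts.load ⟨hm₁, fun i hi => ?_, ?_⟩
    · simp [State.setReg, hi.ne, hr₁ i hi]
    · simp [State.setReg, eval, hv₁, hm₁]
  | ite c a b ihc iha ihb =>
    simp only [bound, max_le_iff] at he
    simp only [compile, cost, Polynomial.eval_add, Polynomial.eval_one]
    refine (ihc he.1 d hd s ρ hN hρ).seq fun s₁ ⟨hm₁, hr₁, hv₁⟩ => ?_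
    have h0 : s₁.reg 0 = N := by rw [hr₁ 0 (by omega), hN]
    have h1 : ∀ i < D, s₁.reg (i + 1) = ρ i := fun i hi => by rw [hr₁ _ (by omega), hρ i hi]
    by_cases hc : s₁.reg d = 0
    · obtain ⟨t, s₂, hE, ht, hm₂, hr₂, hv₂⟩ := ihb he.2.2 d hd s₁ ρ h0 h1
      refine ⟨_, s₂, .ite_false hc hE, by omega, hm₂.trans hm₁,
        fun i hi => (hr₂ i hi).trans (hr₁ i hi), ?_⟩
      rw [hv₁] at hc
      simp [eval, hc, hv₂, hm₁]
    · obtain ⟨t, s₂, hE, ht, hm₂, hr₂, hv₂⟩ := iha he.2.1 d hd s₁ ρ h0 h1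
      refine ⟨_, s₂, .ite_true hc hE, by omega, hm₂.trans hm₁,
        fun i hi => (hr₂ i hi).trans (hr₁ i hi), ?_⟩
      rw [hv₁] at hc
      simp [eval, hc, hv₂, hm₁]
  | sum v e ih =>
    simp only [bound, max_le_iff] at he
    have hT : (Expr.cost (.sum v e)).eval N
        = 1 + (1 + (1 + (1 + ((N * (e.cost.eval N + 4 + 1) + 1) + (1 + 1))))) := by
      simp only [cost, Polynomial.eval_add, Polynomial.eval_mul, Polynomial.eval_X,
        Polynomial.eval_ofNat]
      ring
    rw [hT]
    refine .const_seq <| .add_seq <| .add_seq <| .const_seq <| Halts.seq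
      (Q := fun s' => s'.mem = s.mem ∧ (∀ i < d, i ≠ v + 1 → s'.reg i = s.reg i) ∧
        s'.reg (d + 1) = s.reg (v + 1) ∧ s'.reg d = eval N s.mem (.sum v e) ρ) ?_ ?_
    · refine Halts.mono (Halts.while_countdown (c := d + 2)
        (fun k s' => ∃ j, j + k = N ∧ s'.mem = s.mem ∧
          (∀ i < d, i ≠ v + 1 → s'.reg i = s.reg i) ∧ s'.reg (d + 1) = s.reg (v + 1) ∧
          s'.reg (v + 1) = j ∧
          s'.reg d = ∑ l ∈ Finset.range j, e.eval N s.mem (Function.update ρ v l)) ?_ N _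
        ⟨0, by simp, rfl, ?_, ?_, ?_, ?_⟩ ?_) le_rfl ?_
      · rintro k s₁ ⟨j, hj, hm, hr, hs, hv, hsum⟩ hk
        refine (Halts.seq (T' := 1 + (1 + (1 + 1))) (ih he.2 (d + 3) (by omega) s₁
          (Function.update ρ v j) (by rw [hr 0 (by omega) (by omega), hN]) fun i hi => ?_) ?_).mono
            le_rfl fun _ h => h
        · by_cases hiv : i = v
          · subst hiv; simpa using hv
          · rw [hr _ (by omega) (by omega), hρ i hi, Function.update_of_ne hiv]
        · rintro s₂ ⟨hm₂, hr₂, hv₂⟩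
          refine .add_seq <| .const_seq <| .add_seq <| .sub ⟨⟨j + 1, by omega, ?_⟩, ?_⟩
          · refine ⟨hm₂.trans hm, fun i hi hiv => ?_, ?_, ?_, ?_⟩
            · simp [State.setReg, Function.update_apply, (show i ≠ d by omega),
                (show i ≠ d + 2 by omega), (show i ≠ d + 3 by omega), hiv, hr₂ i (by omega), hr i hi hiv]
            · simp [State.setReg, Function.update_apply, (show d ≠ v by omega), hr₂ (d + 1), hs]
            · simp [State.setReg, Function.update_apply, (show v ≠ d + 1 by omega),
                (show v ≠ d + 2 by omega), (show v + 1 ≠ d by omega), hr₂ (v + 1) (by omega), hv]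
            · simp [State.setReg, Function.update_apply, (show d ≠ v + 1 by omega),
                hr₂ d (by omega), hv₂, hsum, hm, Finset.sum_range_succ]
          · simp [State.setReg, Function.update_apply, (show d + 1 ≠ v by omega),
              (show d + 2 ≠ v by omega), hr₂ (d + 2), hk]
      · intro i hi hiv
        simp [State.setReg, Function.update_apply, hiv, (show i ≠ d by omega),
          (show i ≠ d + 1 by omega), (show i ≠ d + 2 by omega)]
      · simp [State.setReg, Function.update_apply, (show d ≠ v by omega),
          (show v + 1 ≠ d by omega)]
      · simp [State.setReg]
      · simp [State.setReg, Function.update_apply, (show d ≠ v + 1 by omega)]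
      · simp [State.setReg, Function.update_apply, (show d + 1 ≠ v by omega),
          (show 0 ≠ d by omega), hN]
      · rintro s' ⟨j, hj, h⟩
        obtain rfl : j = N := by omega
        exact ⟨h.1, h.2.1, h.2.2.1, h.2.2.2.2⟩
    · rintro s' ⟨hm, hr, hs, hv⟩
      refine .const_seq <| .add ⟨hm, fun i hi => ?_, ?_⟩
      · by_cases hiv : i = v + 1
        · subst hiv; simp [State.setReg, hs]
        · simp [State.setReg, hiv, (show i ≠ d + 3 by omega), hr i hi hiv]
      · simp [State.setReg, (show d ≠ v + 1 by omega), hv]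

end Expr

/-! ### Tables -/

/-- The memory after the cells `2 * N, …, 2 * N + k - 1` have been filled one after the other, cell
`j` with the value of `E` for the number `j` in variable `0`. -/
def table (E : Expr) (N : ℕ) (m : ℕ → ℕ) : ℕ → ℕ → ℕ
  | 0 => m
  | k + 1 => Function.update (table E N m k) (N + N + k)
      (E.eval N (table E N m k) (Function.update (fun _ => 0) 0 (N + N + k)))

/-- There is a polynomial-time program that fills `N ^ 2` cells of a table and then evaluates an
expression. -/
theorem exists_prog_table (E F : Expr) :
    ∃ (P : Prog) (p : Polynomial ℕ), ∀ w : List Bool, ∃ ρ : ℕ → ℕ,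
      Halts P (init w) (p.eval w.length) fun s =>
        s.reg 0 = F.eval w.length
          (table E w.length (init w).mem (w.length * w.length)) ρ := by
  -- The maximum with `1` keeps register `1`, which holds variable `0` and thus the current table
  -- address, out of the scratch space.
  set D := max (max E.bound F.bound) 1 with hD
  have hE : E.bound ≤ D := by omega
  have hF : F.bound ≤ D := by omega
  have hS : (Expr.sum 0 .size).bound ≤ D := by simp [Expr.bound]; omega
  refine ⟨.seq ((Expr.sum 0 .size).compile (D + 1)) (.seq (.add 1 0 0) (.seq
      (.while (D + 1) (.seq (E.compile (D + 2)) (.seq (.store 1 (D + 2)) (.seq (.const (D + 2) 1)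
        (.seq (.add 1 1 (D + 2)) (.sub (D + 1) (D + 1) (D + 2)))))))
      (.seq (F.compile (D + 1)) (.seq (.const (D + 2) 0) (.add 0 (D + 1) (D + 2)))))),
    (Expr.sum 0 .size).cost + (1 + ((Polynomial.X * Polynomial.X * (E.cost + 4 + 1) + 1) +
      (F.cost + (1 + 1)))), fun w => ?_⟩
  set N := w.length with hNw
  set m := (init w).mem with hm
  have h0 : (init w).reg 0 = N := by simp [init, hNw]
  have h1 : ∀ i, (init w).reg (i + 1) = 0 := fun i => by simp [init]
  -- When the loop ends, variable `0` points just past the last cell of the table.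
  refine ⟨Function.update (fun _ => 0) 0 (N + N + N * N), ?_⟩
  simp only [Polynomial.eval_add, Polynomial.eval_mul, Polynomial.eval_X, Polynomial.eval_ofNat,
    Polynomial.eval_one]
  refine ((Expr.sum 0 .size).halts_compile hS (D + 1) (by omega) _ (fun _ => 0) h0
    fun i _ => h1 i).seq ?_
  rintro s₁ ⟨hm₁, hr₁, hv₁⟩
  refine .add_seq <| Halts.seq (Q := fun s => s.mem = table E N m (N * N) ∧ s.reg 0 = N ∧
    ∀ i < D, s.reg (i + 1) = Function.update (fun _ => 0) 0 (N + N + N * N) i) ?_ ?_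
  · refine Halts.mono (Halts.while_countdown (c := D + 1) (fun k s => ∃ j, j + k = N * N ∧
      s.mem = table E N m j ∧ s.reg 0 = N ∧
      ∀ i < D, s.reg (i + 1) = Function.update (fun _ => 0) 0 (N + N + j) i) ?_ (N * N) _
      ⟨0, by simp, hm₁, ?_, fun i hi => ?_⟩ ?_) le_rfl ?_
    · rintro k s ⟨j, hj, hmj, hs, hr⟩ hk
      refine Halts.seq (T' := 1 + (1 + (1 + 1))) (E.halts_compile hE (D + 2) (by omega) s _ hs hr) ?_
      rintro s₂ ⟨hm₂, hr₂, hv₂⟩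
      have hr1 : s₂.reg 1 = N + N + j := by
        rw [hr₂ 1 (by omega), hr 0 (by omega)]; simp
      refine .store_seq <| .const_seq <| .add_seq <| .sub ⟨⟨j + 1, by omega, ?_, ?_, ?_⟩, ?_⟩
      · simp [State.setReg, State.setMem, hr1, hm₂, hv₂, hmj, table]
      · simp [State.setReg, State.setMem, hr₂ 0, hs]
      · intro i hi
        rcases eq_or_ne i 0 with rfl | hi0
        · simp [State.setReg, State.setMem, hr1, (show D ≠ 0 by omega)]
          omega
        · have := hr i hi
          simp only [Function.update_of_ne hi0] at this ⊢
          simp [State.setReg, State.setMem, Function.update_apply, hi0, hr₂ (i + 1) (by omega),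
            (show i ≠ D by omega), (show i ≠ D + 1 by omega), this]
      · simp [State.setReg, State.setMem, (show D ≠ 0 by omega), hr₂ (D + 1), hk]
    · simp [State.setReg, hr₁ 0, h0]
    · rcases eq_or_ne i 0 with rfl | hi0
      · simp [State.setReg, hr₁ 0, h0]
      · simp [State.setReg, hr₁ (i + 1) (by omega), h1, hi0]
    · simp [State.setReg, (show D ≠ 0 by omega), hv₁, Expr.eval]
    · rintro s ⟨j, hj, h⟩
      obtain rfl : j = N * N := by omega
      exact h
  · rintro s₂ ⟨hm₂, hs₂, hr₂⟩
    refine (F.halts_compile hF (D + 1) (by omega) s₂ _ hs₂ hr₂).seq ?_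
    rintro s₃ ⟨-, -, hv₃⟩
    refine .const_seq <| .add ?_
    simp [State.setReg, hv₃, hm₂]

end RAM

/-! ### Power-preserving maps between finite nilpotent groups -/

section PowerMaps

variable {G H : Type*} [Group G] [Group H]

theorem zpowers_eq_zpowers_of_pow {a b : G} {m l : ℕ} (h : b = a ^ m) (h' : a = b ^ l) :
    Subgroup.zpowers a = Subgroup.zpowers b :=
  le_antisymm (Subgroup.zpowers_le.2 (h' ▸ Subgroup.pow_mem _ (Subgroup.mem_zpowers b) l))
    (Subgroup.zpowers_le.2 (h ▸ Subgroup.pow_mem _ (Subgroup.mem_zpowers a) m))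

variable [Finite G] [Finite H]

/-- If `x` and `y ^ p` generate the same subgroup of a `p`-element `y ≠ 1`, then `y` has a power
that generates the same subgroup as `y` and has `p`-th power `x`. -/
theorem exists_pow_pow_eq_of_zpowers_eq {p k : ℕ} (hp : p.Prime) {x y : H}
    (hy : orderOf y = p ^ (k + 1)) (hxy : Subgroup.zpowers x = Subgroup.zpowers (y ^ p)) :
    ∃ m : ℕ, (y ^ m) ^ p = x ∧ Subgroup.zpowers (y ^ m) = Subgroup.zpowers y := by
  have hx : x ∈ Subgroup.zpowers (y ^ p) := hxy ▸ Subgroup.mem_zpowers x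
  obtain ⟨m, rfl⟩ := (mem_powers_iff_mem_zpowers).2 hx
  have ho : orderOf (y ^ p) = p ^ k := by
    rw [orderOf_pow_of_dvd hp.ne_zero (by rw [hy]; exact dvd_pow_self p k.succ_ne_zero), hy,
      pow_succ, Nat.mul_div_cancel _ hp.pos]
  have key : ∀ m : ℕ, m.Coprime p → Subgroup.zpowers (y ^ m) = Subgroup.zpowers y := fun m hm => by
    refine Subgroup.eq_of_le_of_card_ge
      (Subgroup.zpowers_le.2 (Subgroup.pow_mem _ (Subgroup.mem_zpowers y) m)) ?_
    rw [Nat.card_zpowers, Nat.card_zpowers, Nat.Coprime.orderOf_pow]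
    rw [hy]
    exact (hm.pow_right _).symm
  -- If `y` has order `p`, then `x = 1` and `y` itself works; otherwise comparing orders forces the
  -- exponent to be coprime to `p`.
  rcases k.eq_zero_or_pos with rfl | hk
  · have h1 : y ^ p = 1 := by simpa using ho
    exact ⟨1, by simp [h1], by simp⟩
  · have hm : m.Coprime p := by
      have := congrArg Nat.card (congrArg (fun K : Subgroup H => (K : Type _)) hxy)
      simp only [Nat.card_zpowers] at this
      rw [orderOf_pow, Nat.div_eq_self, ho] at this
      rcases this with h | h
      · exact absurd h (pow_ne_zero _ hp.ne_zero)
      · exact (Nat.Coprime.coprime_dvd_left (dvd_pow_self p hk.ne') h).symm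
    exact ⟨m, by simp only [← pow_mul, mul_comm], key m hm⟩

/-- A colouring of two finite groups from which the orders of the elements can be read off, which
is constant on the generators of each cyclic subgroup, and for which elements of the same colour
have as many roots of each colour. -/
structure IsRootColoring {κ : Type*} (c : G → κ) (c' : H → κ) : Prop where
  orderOf_eq : ∃ o : κ → ℕ, (∀ x, orderOf x = o (c x)) ∧ ∀ x, orderOf x = o (c' x)
  color_eq_left : ∀ x y : G, Subgroup.zpowers x = Subgroup.zpowers y → c x = c y
  color_eq_right : ∀ x y : H, Subgroup.zpowers x = Subgroup.zpowers y → c' x = c' y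
  ncard_eq : ∀ x y, c x = c' y → ∀ z,
    {g | x ∈ Subgroup.zpowers g ∧ c g = z}.ncard = {h | y ∈ Subgroup.zpowers h ∧ c' h = z}.ncard
  color_one : c 1 = c' 1

/-- A set of elements of `G` that is closed under powers together with an injective map into `H`
that preserves powers and colours. -/
structure IsPartialPowerMap {κ : Type*} (c : G → κ) (c' : H → κ) (D : Set G) (f : G → H) :
    Prop where
  pow_mem : ∀ x ∈ D, ∀ m : ℕ, x ^ m ∈ D
  map_pow : ∀ x ∈ D, ∀ m : ℕ, f (x ^ m) = f x ^ m
  injOn : D.InjOn f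
  color_map : ∀ x ∈ D, c x = c' (f x)

variable {κ : Type*} {c : G → κ} {c' : H → κ}

/-- A counting argument: `y ^ p` and its image have equally many roots of the colour of `y`, and `y`
is one that lies outside `D`. So the roots inside `D` cannot account for all roots of the image. -/
theorem IsPartialPowerMap.exists_root {D : Set G} {f : G → H} (hf : IsPartialPowerMap c c' D f)
    (hc : IsRootColoring c c') {p k : ℕ} (hp : p.Prime) {y : G} (hy : orderOf y = p ^ (k + 1))
    (hyD : y ∉ D) (hypD : y ^ p ∈ D) :
    ∃ z : H, z ∉ f '' D ∧ c y = c' z ∧ f (y ^ p) = z ^ p := by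
  obtain ⟨o, ho, ho'⟩ := hc.orderOf_eq
  set x := y ^ p with hx
  have hox : orderOf x = p ^ k := by
    rw [hx, orderOf_pow_of_dvd hp.ne_zero (by rw [hy]; exact dvd_pow_self p k.succ_ne_zero), hy,
      pow_succ, Nat.mul_div_cancel _ hp.pos]
  have hofx : orderOf (f x) = p ^ k := by rw [ho', ← hf.color_map x hypD, ← ho, hox]
  set K := {g | x ∈ Subgroup.zpowers g ∧ c g = c y} with hK
  set K' := {h | f x ∈ Subgroup.zpowers h ∧ c' h = c y} with hK'
  have hcard : K.ncard = K'.ncard := hc.ncard_eq x (f x) (hf.color_map x hypD) (c y)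
  have hyK : y ∈ K := ⟨Subgroup.pow_mem _ (Subgroup.mem_zpowers y) p, rfl⟩
  have hlt : (f '' (K ∩ D)).ncard < K'.ncard := by
    rw [(hf.injOn.mono Set.inter_subset_right).ncard_image, ← hcard]
    exact Set.ncard_lt_ncard ⟨Set.inter_subset_left, fun h => hyD (h hyK).2⟩ (Set.toFinite _)
  obtain ⟨z, hz, hzn⟩ := Set.exists_mem_notMem_of_ncard_lt_ncard hlt (Set.toFinite _)
  have hoz : orderOf z = p ^ (k + 1) := by rw [ho', hz.2, ← ho, hy]
  have hzD : z ∉ f '' D := by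
    rintro ⟨a, haD, rfl⟩
    refine hzn ⟨a, ⟨⟨?_, (hf.color_map a haD).trans hz.2⟩, haD⟩, rfl⟩
    obtain ⟨m, hm⟩ := mem_powers_iff_mem_zpowers.2 hz.1
    simp only [← hf.map_pow a haD] at hm
    rw [← hf.injOn (hf.pow_mem a haD m) hypD hm]
    exact Subgroup.pow_mem _ (Subgroup.mem_zpowers a) m
  have hzp : Subgroup.zpowers (f x) = Subgroup.zpowers (z ^ p) := by
    obtain ⟨m, hm⟩ := mem_powers_iff_mem_zpowers.2 hz.1
    simp only at hm
    -- Otherwise `z ^ m = f x` would have the order `p ^ (k + 1)` of `z`, not `p ^ k`.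
    have hpm : p ∣ m := by
      by_contra h
      have : orderOf (z ^ m) = orderOf z := Nat.Coprime.orderOf_pow (by
        rw [hoz]; exact ((hp.coprime_iff_not_dvd.2 h).pow_left _))
      rw [hm, hofx, hoz] at this
      exact absurd (Nat.pow_right_injective hp.two_le this) (by omega)
    obtain ⟨l, rfl⟩ := hpm
    refine Subgroup.eq_of_le_of_card_ge (Subgroup.zpowers_le.2 ?_) ?_
    · rw [← hm, pow_mul]
      exact Subgroup.pow_mem _ (Subgroup.mem_zpowers _) l
    · rw [Nat.card_zpowers, Nat.card_zpowers, hofx, orderOf_pow_of_dvd hp.ne_zero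
        (by rw [hoz]; exact dvd_pow_self p k.succ_ne_zero), hoz, pow_succ,
        Nat.mul_div_cancel _ hp.pos]
  -- So far `z ^ p` only generates the same subgroup as `f x`; another generator of the group of `z`
  -- has `p`-th power exactly `f x`.
  obtain ⟨m, hm, hzm⟩ := exists_pow_pow_eq_of_zpowers_eq hp hoz hzp
  refine ⟨z ^ m, ?_, ?_, hm.symm⟩
  · rintro ⟨a, haD, ha⟩
    obtain ⟨l, hl⟩ := mem_powers_iff_mem_zpowers.2 (hzm ▸ Subgroup.mem_zpowers z)
    exact hzD ⟨a ^ l, hf.pow_mem a haD l, by rw [hf.map_pow a haD, ha]; exact hl⟩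
  · rw [hc.color_eq_right _ _ hzm, hz.2]

-- Send `y ^ m` to `z ^ m` for the root `z` of `exists_root`. Since `y` and `z` have equal order
-- this is well defined and injective; it agrees with `f` on `D` because only the powers of `y ^ p`
-- lie in `D`, and it creates no collision because no generator of the group of `z` is in the image
-- of `D`.
open Classical in
theorem IsPartialPowerMap.exists_extension {D : Set G} {f : G → H}
    (hf : IsPartialPowerMap c c' D f)
    (hc : IsRootColoring c c') {p k : ℕ} (hp : p.Prime) {y : G} (hy : orderOf y = p ^ (k + 1))
    (hyD : y ∉ D) (hypD : y ^ p ∈ D) :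
    ∃ f' : G → H, IsPartialPowerMap c c' (D ∪ Subgroup.zpowers y) f' := by
  obtain ⟨z, hzD, hyz, hfz⟩ := hf.exists_root hc hp hy hyD hypD
  obtain ⟨o, ho, ho'⟩ := hc.orderOf_eq
  have hoz : orderOf z = orderOf y := by rw [ho', ho, hyz]
  have hcop : ∀ m : ℕ, m.Coprime p → ∃ l : ℕ, y = (y ^ m) ^ l ∧ z = (z ^ m) ^ l := by
    intro m hm
    obtain ⟨l, hl⟩ := exists_pow_eq_self_of_coprime (x := y) (n := m) (by
      rw [hy]; exact (hm.pow_right _))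
    -- The same exponent serves for `z`, since `y` and `z` have equal order.
    refine ⟨l, hl.symm, ?_⟩
    rw [← pow_mul] at hl ⊢
    have : y ^ (m * l) = y ^ 1 := by simpa using hl
    rw [pow_eq_pow_iff_modEq, ← hoz, ← pow_eq_pow_iff_modEq] at this
    simpa using this.symm
  have hdvd : ∀ m : ℕ, y ^ m ∈ D ↔ p ∣ m := by
    intro m
    constructor
    · intro h
      by_contra hpm
      obtain ⟨l, hl, -⟩ := hcop m (hp.coprime_iff_not_dvd.2 hpm).symm
      exact hyD (hl ▸ hf.pow_mem _ h l)
    · rintro ⟨l, rfl⟩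
      rw [pow_mul]
      exact hf.pow_mem _ hypD l
  have hex : ∀ a : G, ∃ m : ℕ, a ∈ Subgroup.zpowers y → y ^ m = a := fun a => by
    by_cases h : a ∈ Subgroup.zpowers y
    · obtain ⟨m, hm⟩ := mem_powers_iff_mem_zpowers.2 h
      exact ⟨m, fun _ => hm⟩
    · exact ⟨0, fun h' => absurd h' h⟩
  choose e he using hex
  set f' : G → H := fun a => if a ∈ D then f a else z ^ e a with hf'
  have hD : ∀ a ∈ D, f' a = f a := fun a ha => if_pos ha
  have hyp : ∀ m : ℕ, f' (y ^ m) = z ^ m := by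
    intro m
    by_cases h : y ^ m ∈ D
    · rw [hD _ h]
      obtain ⟨l, rfl⟩ := (hdvd m).1 h
      rw [pow_mul, hf.map_pow _ hypD, hfz, pow_mul]
    · rw [hf']
      simp only [h, if_false]
      rw [pow_eq_pow_iff_modEq, hoz, ← pow_eq_pow_iff_modEq]
      exact he _ (Subgroup.pow_mem _ (Subgroup.mem_zpowers y) m)
  have hmem : ∀ a ∈ D ∪ Subgroup.zpowers y, a ∈ D ∨ ∃ m : ℕ, a = y ^ m ∧ ¬ p ∣ m := by
    intro a ha
    by_cases haD : a ∈ D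
    · exact .inl haD
    · rcases ha with ha | ha
      · exact .inl ha
      · obtain ⟨m, rfl⟩ := mem_powers_iff_mem_zpowers.2 ha
        exact .inr ⟨m, rfl, fun h => haD ((hdvd m).2 h)⟩
  have hne : ∀ a ∈ D, ∀ m : ℕ, ¬ p ∣ m → f a ≠ z ^ m := by
    intro a ha m hm h
    obtain ⟨l, -, hl⟩ := hcop m (hp.coprime_iff_not_dvd.2 hm).symm
    exact hzD ⟨a ^ l, hf.pow_mem a ha l, by rw [hf.map_pow a ha, h, ← hl]⟩
  refine ⟨f', ⟨?_, ?_, ?_, ?_⟩⟩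
  · rintro x (hx | hx) m
    · exact .inl (hf.pow_mem x hx m)
    · exact .inr (Subgroup.pow_mem _ hx m)
  · intro x hx m
    rcases hmem x hx with hx | ⟨l, rfl, -⟩
    · rw [hD _ (hf.pow_mem x hx m), hD x hx, hf.map_pow x hx]
    · rw [← pow_mul, hyp, hyp, pow_mul]
  · intro a ha b hb hab
    rcases hmem a ha with ha | ⟨m, rfl, hm⟩ <;> rcases hmem b hb with hb | ⟨l, rfl, hl⟩
    · rw [hD a ha, hD b hb] at hab
      exact hf.injOn ha hb hab
    · rw [hD a ha, hyp] at hab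
      exact absurd hab (hne a ha l hl)
    · rw [hD b hb, hyp] at hab
      exact absurd hab.symm (hne b hb m hm)
    · rwa [hyp, hyp, pow_eq_pow_iff_modEq, hoz, ← pow_eq_pow_iff_modEq] at hab
  · intro a ha
    rcases hmem a ha with ha | ⟨m, rfl, hm⟩
    · rw [hD a ha, hf.color_map a ha]
    · obtain ⟨l, hl, hl'⟩ := hcop m (hp.coprime_iff_not_dvd.2 hm).symm
      rw [hyp, ← hc.color_eq_left _ _ (zpowers_eq_zpowers_of_pow rfl hl),
        ← hc.color_eq_right _ _ (zpowers_eq_zpowers_of_pow rfl hl'), hyz]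

/-- There is an injective map that preserves powers on the elements of prime power order. -/
theorem IsRootColoring.exists_isPartialPowerMap (hc : IsRootColoring c c') :
    ∃ D f, IsPartialPowerMap c c' D f ∧
      ∀ (p k : ℕ), p.Prime → ∀ y : G, orderOf y = p ^ k → y ∈ D := by
  obtain ⟨D, ⟨⟨f, hf⟩, h1⟩, hmax⟩ := Set.Finite.exists_maximal
    (s := {D : Set G | (∃ f : G → H, IsPartialPowerMap c c' D f) ∧ (1 : G) ∈ D}) (Set.toFinite _)
    ⟨{1}, ⟨⟨fun _ => 1, by simp, by simp, by simp, by simpa using hc.color_one⟩, rfl⟩⟩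
  refine ⟨D, f, hf, fun p k hp => ?_⟩
  induction k with
  | zero =>
    intro y hy
    rw [pow_zero, orderOf_eq_one_iff] at hy
    exact hy ▸ h1
  | succ k ih =>
    intro y hy
    by_contra hyD
    have hyp : y ^ p ∈ D := ih _ (by
      rw [orderOf_pow_of_dvd hp.ne_zero (by rw [hy]; exact dvd_pow_self p k.succ_ne_zero), hy,
        pow_succ, Nat.mul_div_cancel _ hp.pos])
    exact hyD (hmax ⟨hf.exists_extension hc hp hy hyD hyp, .inl h1⟩ Set.subset_union_left
      (.inr (Subgroup.mem_zpowers y)))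

theorem directedPowerGraph_adj_iff_mem_zpowers {K : Type*} [Group K] {x y : K} :
    (directedPowerGraph K).Adj x y ↔ y ∈ Subgroup.zpowers x := by
  simp [directedPowerGraph, Subgroup.mem_zpowers_iff, eq_comm]

/-- A bijection that preserves powers is an isomorphism of the directed power graphs. -/
theorem directedPowerGraph_isomorphic_of_map_pow {f : G → H} (hf : Function.Bijective f)
    (hpow : ∀ x, ∀ m : ℕ, f (x ^ m) = f x ^ m) :
    (directedPowerGraph G).Isomorphic (directedPowerGraph H) := by
  refine ⟨⟨Equiv.ofBijective f hf, fun {a b} => ?_⟩⟩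
  simp only [Equiv.ofBijective_apply, directedPowerGraph_adj_iff_mem_zpowers,
    ← mem_powers_iff_mem_zpowers, Submonoid.mem_powers_iff, ← hpow, hf.injective.eq_iff]

/-- In a finite nilpotent group the Sylow `p`-subgroup is normal, hence unique, so it contains every
`p`-subgroup. -/
theorem mem_sylow_of_orderOf_eq_pow [Group.IsNilpotent H] {p k : ℕ} [Fact p.Prime] (Q : Sylow p H)
    {x : H} (hx : orderOf x = p ^ k) : x ∈ Q := by
  have := Sylow.unique_of_normal Q inferInstance
  obtain ⟨Q', hQ'⟩ := (IsPGroup.of_card (by rw [Nat.card_zpowers, hx]) :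
    IsPGroup p (Subgroup.zpowers x)).exists_le_sylow
  exact Subsingleton.elim Q' Q ▸ hQ' (Subgroup.mem_zpowers x)

/-- The directed power graphs of two finite nilpotent groups of the same order are isomorphic if
there is a common colouring with equal numbers of roots. -/
theorem IsRootColoring.directedPowerGraph_isomorphic [Group.IsNilpotent G] [Group.IsNilpotent H]
    (hc : IsRootColoring c c') (hcard : Nat.card G = Nat.card H) :
    (directedPowerGraph G).Isomorphic (directedPowerGraph H) := by
  obtain ⟨o, ho, ho'⟩ := hc.orderOf_eq
  obtain ⟨D, f, hf, hD⟩ := hc.exists_isPartialPowerMap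
  -- A finite nilpotent group is the direct product of its Sylow subgroups. The inner product over
  -- all `P : Sylow p G` has a single factor, as Sylow subgroups are unique here.
  obtain ⟨eG⟩ := ((Group.isNilpotent_of_finite_tfae (G := G)).out 0 4 rfl rfl).1 inferInstance
  obtain ⟨eH⟩ := ((Group.isNilpotent_of_finite_tfae (G := H)).out 0 4 rfl rfl).1 inferInstance
  rw [← hcard] at eH
  have hprime : ∀ p : (Nat.card G).primeFactors, Fact (p : ℕ).Prime :=
    fun p => ⟨Nat.prime_of_mem_primeFactors p.2⟩
  have hPD : ∀ (p : (Nat.card G).primeFactors) (P : Sylow p G), ∀ x ∈ P, x ∈ D ∧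
      ∀ Q : Sylow p H, f x ∈ Q := by
    intro p P x hx
    obtain ⟨k, hk⟩ := IsPGroup.iff_orderOf.1 P.isPGroup' ⟨x, hx⟩
    rw [Subgroup.orderOf_mk] at hk
    have hxD := hD p k (hprime p).out x hk
    exact ⟨hxD, fun Q => mem_sylow_of_orderOf_eq_pow (k := k) Q
      (by rw [ho', ← hf.color_map x hxD, ← ho, hk])⟩
  have hsub : ∀ p : (Nat.card G).primeFactors, Subsingleton (Sylow p G) := fun p =>
    @Unique.instSubsingleton _ (Sylow.unique_of_normal (default : Sylow p G) inferInstance)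
  set Φ : (∀ p : (Nat.card G).primeFactors, ∀ P : Sylow p G, (P : Subgroup G)) →
      (∀ p : (Nat.card G).primeFactors, ∀ Q : Sylow p H, (Q : Subgroup H)) :=
    fun x p Q => ⟨f (x p default), (hPD p default _ (x p default).2).2 Q⟩ with hΦ
  have hΦi : Function.Injective Φ := by
    intro x y hxy
    funext p P
    obtain rfl := Subsingleton.elim default P
    have := congrArg Subtype.val (congrFun (congrFun hxy p) default)
    exact Subtype.ext (hf.injOn (hPD p default _ (x p default).2).1
      (hPD p default _ (y p default).2).1 this)
  have hinj : Function.Injective (fun x => eH (Φ (eG.symm x))) :=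
    eH.injective.comp (hΦi.comp eG.symm.injective)
  refine directedPowerGraph_isomorphic_of_map_pow (f := fun x => eH (Φ (eG.symm x)))
    ((Nat.bijective_iff_injective_and_card _).2 ⟨hinj, hcard⟩) fun x m => ?_
  rw [← map_pow, map_pow]
  congr 1
  funext p Q
  exact Subtype.ext (hf.map_pow _ (hPD p default _ (eG.symm x p default).2).1 m)

end PowerMaps

/-! ### Colour refinement -/

/-- The colours `c r x` of the vertices `x < N` after `r` rounds of colour refinement by the number
of out-neighbours and the numbers of in-neighbours of each colour. -/
structure IsColorRefinement (B : ℕ → ℕ → Prop) (N : ℕ) (c : ℕ → ℕ → ℕ) : Prop where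
  zero : ∀ x < N, c 0 x = 0
  lt : ∀ r ≤ N, ∀ x < N, c r x < N
  succ_eq_iff : ∀ r < N, ∀ x < N, ∀ y < N, c (r + 1) x = c (r + 1) y ↔
    c r x = c r y ∧ {v | v < N ∧ B x v}.ncard = {v | v < N ∧ B y v}.ncard ∧
      ∀ z < N, {w | w < N ∧ B w x ∧ c r w = z}.ncard = {w | w < N ∧ B w y ∧ c r w = z}.ncard

namespace IsColorRefinement

variable {B : ℕ → ℕ → Prop} {N : ℕ} {c : ℕ → ℕ → ℕ}

/-- Automorphisms preserve the colours. -/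
theorem apply_perm (hc : IsColorRefinement B N c) (σ : Equiv.Perm ℕ) (hσ : ∀ x, σ x < N ↔ x < N)
    (hB : ∀ x y, B (σ x) (σ y) ↔ B x y) : ∀ r ≤ N, ∀ x < N, c r (σ x) = c r x := by
  intro r
  induction r with
  | zero => intro _ x hx; rw [hc.zero _ hx, hc.zero _ ((hσ x).2 hx)]
  | succ r ih =>
    intro hr x hx
    refine (hc.succ_eq_iff r hr _ ((hσ x).2 hx) _ hx).2 ⟨ih (by omega) x hx, ?_, fun z _ => ?_⟩
    · rw [← Set.ncard_image_of_injective {v | v < N ∧ B x v} σ.injective]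
      congr 1
      ext v
      obtain ⟨v, rfl⟩ := σ.surjective v
      simp [hσ, hB]
    · rw [← Set.ncard_image_of_injective {w | w < N ∧ B w x ∧ c r w = z} σ.injective]
      congr 1
      ext w
      obtain ⟨w, rfl⟩ := σ.surjective w
      simp only [Set.mem_ofPred_eq, hσ, hB, Set.mem_image, EmbeddingLike.apply_eq_iff_eq,
        exists_eq_right]
      exact and_congr_right fun hw => by rw [ih (by omega) w hw]

/-- Vertices with the same in-neighbours and the same out-degree get the same colour. -/
theorem eq_of_twins (hc : IsColorRefinement B N c) {x y : ℕ} (hx : x < N) (hy : y < N)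
    (hin : ∀ w, B w x ↔ B w y)
    (hout : {v | v < N ∧ B x v}.ncard = {v | v < N ∧ B y v}.ncard) : ∀ r ≤ N, c r x = c r y := by
  intro r
  induction r with
  | zero => intro _; rw [hc.zero _ hx, hc.zero _ hy]
  | succ r ih =>
    intro hr
    exact (hc.succ_eq_iff r hr _ hx _ hy).2 ⟨ih (by omega), hout, fun z _ => by simp only [hin]⟩

theorem eq_of_le (hc : IsColorRefinement B N c) {x y : ℕ} (hx : x < N) (hy : y < N) {r s : ℕ}
    (hrs : r ≤ s) (hs : s ≤ N) (h : c s x = c s y) : c r x = c r y := by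
  induction s, hrs using Nat.le_induction with
  | base => exact h
  | succ s _ ih => exact ih (by omega) ((hc.succ_eq_iff s hs _ hx _ hy).1 h).1

/-- One of the first `N` rounds does not change the partition into colour classes. -/
theorem exists_stable (hc : IsColorRefinement B N c) (hN : 0 < N) :
    ∃ r < N, ∀ x < N, ∀ y < N, c r x = c r y → c (r + 1) x = c (r + 1) y := by
  by_contra! h
  have hlt : ∀ r < N, ((Finset.range N).image (c r)).card
      < ((Finset.range N).image (c (r + 1))).card := by
    intro r hr
    obtain ⟨x, hx, y, hy, hxy, hne⟩ := h r hr
    -- Choosing a representative of each old class embeds the old classes into the new ones; if the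
    -- embedding were onto, no class would have been split.
    have hsec : ∀ z ∈ (Finset.range N).image (c r), ∃ w < N, c r w = z := fun z hz => by
      simpa using hz
    choose! g hgN hg using hsec
    have hmem : ∀ w < N, c r w ∈ (Finset.range N).image (c r) := fun w hw =>
      Finset.mem_image_of_mem _ (Finset.mem_range.2 hw)
    have hinj : Set.InjOn (fun z => c (r + 1) (g z)) ((Finset.range N).image (c r)) := by
      intro z hz z' hz' hzz
      rw [← hg z hz, ← hg z' hz']
      exact ((hc.succ_eq_iff r hr _ (hgN z hz) _ (hgN z' hz')).1 hzz).1
    rw [← Finset.card_image_of_injOn hinj]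
    refine Finset.card_lt_card (Finset.ssubset_iff_subset_ne.2 ⟨fun z hz => ?_, fun heq => ?_⟩)
    · obtain ⟨z', hz', rfl⟩ := Finset.mem_image.1 hz
      exact Finset.mem_image_of_mem _ (Finset.mem_range.2 (hgN z' hz'))
    · have key : ∀ w < N, c (r + 1) w = c (r + 1) (g (c r w)) := by
        intro w hw
        have : c (r + 1) w ∈ (Finset.range N).image (c (r + 1)) :=
          Finset.mem_image_of_mem _ (Finset.mem_range.2 hw)
        rw [← heq] at this
        obtain ⟨z', hz', hz⟩ := Finset.mem_image.1 this
        have := ((hc.succ_eq_iff r hr _ (hgN z' hz') _ hw).1 hz).1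
        rw [hg z' hz'] at this
        rw [← hz, this]
      exact hne (by rw [key x hx, key y hy, hxy])
  have hle : ∀ r ≤ N, r < ((Finset.range N).image (c r)).card := by
    intro r
    induction r with
    | zero =>
      intro _
      exact Finset.card_pos.2 (Finset.Nonempty.image ⟨0, Finset.mem_range.2 hN⟩ _)
    | succ r ih => intro hr; have := ih (by omega); have := hlt r hr; omega
  have := hle N le_rfl
  have := Finset.card_image_le (s := Finset.range N) (f := c N)
  rw [Finset.card_range] at this
  omega

end IsColorRefinement

/-! ### Colour refinement of directed power graphs -/

/-- The disjoint union of two digraphs on `n` vertices, on the natural numbers below `2 * n`. -/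
def unionAdj {n : ℕ} (X Y : Digraph (Fin n)) (u v : ℕ) : Prop :=
  (∃ a b : Fin n, u = a ∧ v = b ∧ X.Adj a b) ∨ ∃ a b : Fin n, u = n + a ∧ v = n + b ∧ Y.Adj a b

/-- The isomorphism and its inverse together give an involution of the union that exchanges the
halves and fixes the isolated numbers from `2 * n` on. -/
theorem IsColorRefinement.of_isomorphic {n N : ℕ} (hn : n + n ≤ N) {X Y : Digraph (Fin n)}
    {c : ℕ → ℕ → ℕ} (hc : IsColorRefinement (unionAdj X Y) N c) (h : X.Isomorphic Y) :
    ∀ u < n, ∃ v < n, c N u = c N (n + v) := by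
  obtain ⟨φ⟩ := h
  set f : ℕ → ℕ := fun u => if hu : u < n then n + φ ⟨u, hu⟩ else
    if hu : u - n < n then φ.symm ⟨u - n, hu⟩ else u with hf
  have f_left : ∀ a : Fin n, f a = n + φ a := fun a => by simp [hf]
  have f_right : ∀ a : Fin n, f (n + a) = φ.symm a := fun a => by simp [hf]
  have f_else : ∀ u, n + n ≤ u → f u = u := fun u hu => by
    simp [hf, (show ¬ u < n by omega), (show ¬ u - n < n by omega)]
  have hsplit : ∀ u : ℕ, (∃ a : Fin n, u = a) ∨ (∃ a : Fin n, u = n + a) ∨ n + n ≤ u := fun u => by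
    by_cases h1 : u < n
    · exact .inl ⟨⟨u, h1⟩, rfl⟩
    · by_cases h2 : u < n + n
      · exact .inr (.inl ⟨⟨u - n, by omega⟩, by simp; omega⟩)
      · exact .inr (.inr (by omega))
  have f_inv : Function.Involutive f := fun u => by
    rcases hsplit u with ⟨a, rfl⟩ | ⟨a, rfl⟩ | hu
    · rw [f_left, f_right, φ.symm_apply_apply]
    · rw [f_right, f_left, φ.apply_symm_apply]
    · rw [f_else u hu, f_else u hu]
  have f_lt : ∀ u < N, f u < N := fun u hu => by
    rcases hsplit u with ⟨a, rfl⟩ | ⟨a, rfl⟩ | hu'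
    · rw [f_left]; omega
    · rw [f_right]; omega
    · rwa [f_else u hu']
  have f_adj : ∀ u v, unionAdj X Y u v → unionAdj X Y (f u) (f v) := by
    rintro u v (⟨a, b, rfl, rfl, h⟩ | ⟨a, b, rfl, rfl, h⟩)
    · exact .inr ⟨φ a, φ b, f_left a, f_left b, φ.map_rel_iff.2 h⟩
    · exact .inl ⟨φ.symm a, φ.symm b, f_right a, f_right b, φ.symm.map_rel_iff.2 h⟩
  intro u hu
  refine ⟨φ ⟨u, hu⟩, (φ ⟨u, hu⟩).2, ?_⟩
  have := hc.apply_perm f_inv.toPerm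
    (fun x => ⟨fun h => by simpa [f_inv x] using f_lt _ h, f_lt x⟩)
    (fun x y => ⟨fun h => by simpa [f_inv x, f_inv y] using f_adj _ _ h, f_adj x y⟩) N le_rfl u
    (by omega)
  rw [← this]
  exact congrArg (c N) (f_left ⟨u, hu⟩)

/-- An injective numbering of the elements of a group by numbers below `N` that identifies the
directed power graph with a union of connected components. -/
structure IsDPowNumbering {G : Type*} [Group G] (B : ℕ → ℕ → Prop) (N : ℕ) (i : G → ℕ) : Prop where
  injective : Function.Injective i
  lt : ∀ g, i g < N
  out_iff : ∀ g v, B (i g) v ↔ ∃ h, i h = v ∧ h ∈ Subgroup.zpowers g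
  in_iff : ∀ g w, B w (i g) ↔ ∃ h, i h = w ∧ g ∈ Subgroup.zpowers h

namespace IsDPowNumbering

variable {G H : Type*} [Group G] [Group H] {B : ℕ → ℕ → Prop} {N : ℕ} {i : G → ℕ} {j : H → ℕ}

theorem ncard_out (hi : IsDPowNumbering B N i) (g : G) :
    {v | v < N ∧ B (i g) v}.ncard = orderOf g := by
  rw [← Nat.card_zpowers, ← SetLike.coe_sort_coe, Nat.card_coe_set_eq,
    ← Set.ncard_image_of_injective _ hi.injective]
  congr 1
  ext v
  simp only [hi.out_iff, Set.mem_ofPred_eq, Set.mem_image, SetLike.mem_coe]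
  exact ⟨fun ⟨_, h, hv, hg⟩ => ⟨h, hg, hv⟩, fun ⟨h, hg, hv⟩ => ⟨hv ▸ hi.lt h, h, hv, hg⟩⟩

theorem ncard_in (hi : IsDPowNumbering B N i) (c : ℕ → ℕ) (g : G) (z : ℕ) :
    {w | w < N ∧ B w (i g) ∧ c w = z}.ncard
      = {h | g ∈ Subgroup.zpowers h ∧ c (i h) = z}.ncard := by
  rw [← Set.ncard_image_of_injective _ hi.injective]
  congr 1
  ext v
  simp only [hi.in_iff, Set.mem_ofPred_eq, Set.mem_image]
  constructor
  · rintro ⟨_, ⟨h, rfl, hg⟩, hz⟩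
    exact ⟨h, ⟨hg, hz⟩, rfl⟩
  · rintro ⟨h, ⟨hg, hz⟩, rfl⟩
    exact ⟨hi.lt h, ⟨h, rfl, hg⟩, hz⟩

/-- Generators of the same cyclic subgroup have the same in- and out-neighbours, so they are twins.
-/
theorem color_eq (hi : IsDPowNumbering B N i) {c : ℕ → ℕ → ℕ} (hc : IsColorRefinement B N c)
    {r : ℕ} (hr : r ≤ N) (x y : G) (h : Subgroup.zpowers x = Subgroup.zpowers y) :
    c r (i x) = c r (i y) := by
  refine hc.eq_of_twins (hi.lt x) (hi.lt y) (fun w => ?_) ?_ r hr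
  · simp only [hi.in_iff, ← Subgroup.zpowers_le, h]
  · simp only [hi.out_iff, h]

theorem isRootColoring [Finite G] [Finite H] (hi : IsDPowNumbering B N i)
    (hj : IsDPowNumbering B N j) {c : ℕ → ℕ → ℕ} (hc : IsColorRefinement B N c)
    (h1 : ∃ h, c N (i 1) = c N (j h)) :
    ∃ r, IsRootColoring (fun g => c r (i g)) (fun h => c r (j h)) := by
  classical
  obtain ⟨r, hr, hstable⟩ := hc.exists_stable (Nat.zero_lt_of_lt (hi.lt 1))
  have hs := fun x hx y hy h => (hc.succ_eq_iff r hr x hx y hy).1 (hstable x hx y hy h)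
  -- Stability makes the out-degree, which is the order, independent of the chosen vertex of colour
  -- `z`.
  set o : ℕ → ℕ := fun z =>
    if h : ∃ x < N, c r x = z then {v | v < N ∧ B h.choose v}.ncard else 0 with ho
  have ho' : ∀ x < N, {v | v < N ∧ B x v}.ncard = o (c r x) := fun x hx => by
    have h : ∃ y < N, c r y = c r x := ⟨x, hx, rfl⟩
    simp only [ho, h, dif_pos]
    exact (hs x hx _ h.choose_spec.1 h.choose_spec.2.symm).2.1
  refine ⟨r, ⟨⟨o, fun x => ?_, fun x => ?_⟩, hi.color_eq hc hr.le, hj.color_eq hc hr.le,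
    fun x y hxy z => ?_, ?_⟩⟩
  · rw [← hi.ncard_out, ho' _ (hi.lt x)]
  · rw [← hj.ncard_out, ho' _ (hj.lt x)]
  · by_cases hz : z < N
    · rw [← hi.ncard_in, ← hj.ncard_in]
      exact (hs _ (hi.lt x) _ (hj.lt y) hxy).2.2 z hz
    · have e1 : ∀ g, c r (i g) ≠ z := fun g hg => hz (hg ▸ hc.lt r hr.le _ (hi.lt g))
      have e2 : ∀ g, c r (j g) ≠ z := fun g hg => hz (hg ▸ hc.lt r hr.le _ (hj.lt g))
      simp [e1, e2]
  · obtain ⟨h, h1⟩ := h1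
    have hr1 := hc.eq_of_le (hi.lt 1) (hj.lt h) hr.le le_rfl h1
    have := (hs _ (hi.lt 1) _ (hj.lt h) hr1).2.1
    -- The partner of the identity has order one, so it is the identity.
    rw [hi.ncard_out, hj.ncard_out, orderOf_one, eq_comm, orderOf_eq_one_iff] at this
    rw [hr1, this]

end IsDPowNumbering

theorem IsColorRefinement.isomorphic {n N : ℕ} (hn : n + n ≤ N) {X Y : Digraph (Fin n)}
    {c : ℕ → ℕ → ℕ} (hc : IsColorRefinement (unionAdj X Y) N c) (hX : IsNilpotentDPow X)
    (hY : IsNilpotentDPow Y) (h : ∀ u < n, ∃ v < n, c N u = c N (n + v)) : X.Isomorphic Y := by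
  obtain ⟨G, _, _, _, ⟨e⟩⟩ := hX
  obtain ⟨H, _, _, _, ⟨e'⟩⟩ := hY
  have adjX : ∀ a b, X.Adj a b ↔ e b ∈ Subgroup.zpowers (e a) := fun a b => by
    rw [← directedPowerGraph_adj_iff_mem_zpowers, e.map_rel_iff]
  have adjY : ∀ a b, Y.Adj a b ↔ e' b ∈ Subgroup.zpowers (e' a) := fun a b => by
    rw [← directedPowerGraph_adj_iff_mem_zpowers, e'.map_rel_iff]
  have hi : IsDPowNumbering (unionAdj X Y) N (fun g => (e.symm g : ℕ)) := by
    refine ⟨fun g h hgh => e.symm.injective (Fin.ext hgh), fun g => by have := (e.symm g).2; omega,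
      fun g v => ⟨?_, ?_⟩, fun g w => ⟨?_, ?_⟩⟩
    · rintro (⟨a, b, ha, rfl, hab⟩ | ⟨a, b, ha, rfl, hab⟩)
      · obtain rfl := Fin.ext ha
        exact ⟨e b, by simp, by simpa [adjX] using hab⟩
      · have := (e.symm g).2; omega
    · rintro ⟨h, rfl, hg⟩
      exact .inl ⟨_, _, rfl, rfl, by simpa [adjX] using hg⟩
    · rintro (⟨a, b, rfl, ha, hab⟩ | ⟨a, b, rfl, ha, hab⟩)
      · obtain rfl := Fin.ext ha
        exact ⟨e a, by simp, by simpa [adjX] using hab⟩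
      · have := (e.symm g).2; omega
    · rintro ⟨h, rfl, hg⟩
      exact .inl ⟨_, _, rfl, rfl, by simpa [adjX] using hg⟩
  have hj : IsDPowNumbering (unionAdj X Y) N (fun g => n + (e'.symm g : ℕ)) := by
    refine ⟨fun g h hgh => e'.symm.injective (Fin.ext (Nat.add_left_cancel hgh)),
      fun g => by have := (e'.symm g).2; omega, fun g v => ⟨?_, ?_⟩, fun g w => ⟨?_, ?_⟩⟩
    · rintro (⟨a, b, ha, rfl, hab⟩ | ⟨a, b, ha, rfl, hab⟩)
      · have := a.2; omega
      · obtain rfl := Fin.ext (Nat.add_left_cancel ha)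
        exact ⟨e' b, by simp, by simpa [adjY] using hab⟩
    · rintro ⟨h, rfl, hg⟩
      exact .inr ⟨_, _, rfl, rfl, by simpa [adjY] using hg⟩
    · rintro (⟨a, b, rfl, ha, hab⟩ | ⟨a, b, rfl, ha, hab⟩)
      · have := b.2; omega
      · obtain rfl := Fin.ext (Nat.add_left_cancel ha)
        exact ⟨e' a, by simp, by simpa [adjY] using hab⟩
    · rintro ⟨h, rfl, hg⟩
      exact .inr ⟨_, _, rfl, rfl, by simpa [adjY] using hg⟩
  -- Only the colour of the identity has to be matched. Every element is a root of the identity, so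
  -- this one match already compares the two groups as a whole.
  obtain ⟨v, hv, h1⟩ := h (e.symm 1) (e.symm 1).2
  obtain ⟨r, hr⟩ := hi.isRootColoring hj hc ⟨e' ⟨v, hv⟩, by simpa using h1⟩
  obtain ⟨φ⟩ := hr.directedPowerGraph_isomorphic
    ((Nat.card_congr e.symm.toEquiv).trans (Nat.card_congr e'.toEquiv))
  exact ⟨e.trans (φ.trans e'.symm)⟩

/-! ### Formulas -/

namespace RAM

namespace Expr

/-- The truth of an expression that is used as a formula. -/
def Holds (N : ℕ) (m : ℕ → ℕ) (p : Expr) (ρ : ℕ → ℕ) : Prop := p.eval N m ρ ≠ 0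

/-- Negation. -/
def not (p : Expr) : Expr := ite p (const 0) (const 1)

/-- Conjunction. -/
def and (p q : Expr) : Expr := ite p q (const 0)

/-- Implication. -/
def imp (p q : Expr) : Expr := ite p q (const 1)

/-- The formula `a < b`. -/
def lt (a b : Expr) : Expr := sub b a

/-- The formula `a ≤ b`. -/
def le (a b : Expr) : Expr := not (lt b a)

/-- The formula `a = b`. -/
def eq (a b : Expr) : Expr := and (le a b) (le b a)

/-- The universal quantifier over the numbers below the length. -/
def all (v : ℕ) (p : Expr) : Expr := not (sum v (not p))

/-- The existential quantifier over the numbers below the length. -/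
def ex (v : ℕ) (p : Expr) : Expr := sum v p

/-- The number of the numbers below the length that satisfy a formula. -/
def count (v : ℕ) (p : Expr) : Expr := sum v (ite p (const 1) (const 0))

/-- The product of `a` and `b` if `a` is at most the length. -/
def mul (a b : Expr) : Expr := sum 12 (ite (lt (var 12) a) b (const 0))

variable {N : ℕ} {m ρ : ℕ → ℕ} {p q a b : Expr} {v : ℕ}

@[simp] theorem eval_const {c : ℕ} : (const c).eval N m ρ = c := rfl
@[simp] theorem eval_size : size.eval N m ρ = N := rfl
@[simp] theorem eval_var {i : ℕ} : (var i).eval N m ρ = ρ i := rfl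
@[simp] theorem eval_add : (add a b).eval N m ρ = a.eval N m ρ + b.eval N m ρ := rfl
@[simp] theorem eval_sub : (sub a b).eval N m ρ = a.eval N m ρ - b.eval N m ρ := rfl
@[simp] theorem eval_load : (load a).eval N m ρ = m (a.eval N m ρ) := rfl

open Classical in
theorem eval_ite :
    (ite p a b).eval N m ρ = if p.Holds N m ρ then a.eval N m ρ else b.eval N m ρ := by
  simp only [eval, Holds]
  congr

theorem eval_sum : (sum v a).eval N m ρ
    = ∑ k ∈ Finset.range N, a.eval N m (Function.update ρ v k) := rfl

@[simp] theorem holds_not : p.not.Holds N m ρ ↔ ¬ p.Holds N m ρ := by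
  simp [Holds, not, eval]

@[simp] theorem holds_and : (p.and q).Holds N m ρ ↔ p.Holds N m ρ ∧ q.Holds N m ρ := by
  simp [Holds, and, eval]

@[simp] theorem holds_imp : (p.imp q).Holds N m ρ ↔ (p.Holds N m ρ → q.Holds N m ρ) := by
  by_cases h : eval N m p ρ = 0 <;> simp [Holds, imp, eval, h]

@[simp] theorem holds_lt : (a.lt b).Holds N m ρ ↔ a.eval N m ρ < b.eval N m ρ := by
  simp [Holds, lt, Nat.sub_eq_zero_iff_le]

@[simp] theorem holds_le : (a.le b).Holds N m ρ ↔ a.eval N m ρ ≤ b.eval N m ρ := by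
  simp [le]

@[simp] theorem holds_eq : (a.eq b).Holds N m ρ ↔ a.eval N m ρ = b.eval N m ρ := by
  simp [eq, le_antisymm_iff]

@[simp] theorem holds_load : (load a).Holds N m ρ ↔ m (a.eval N m ρ) ≠ 0 := Iff.rfl

@[simp] theorem holds_ex :
    (ex v p).Holds N m ρ ↔ ∃ k < N, p.Holds N m (Function.update ρ v k) := by
  simp [Holds, ex, eval_sum]

@[simp] theorem holds_all :
    (all v p).Holds N m ρ ↔ ∀ k < N, p.Holds N m (Function.update ρ v k) := by
  rw [all, holds_not, ← ex, holds_ex]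
  simp

@[simp] theorem eval_count :
    (count v p).eval N m ρ = {k | k < N ∧ p.Holds N m (Function.update ρ v k)}.ncard := by
  classical
  simp only [count, eval_sum, eval_ite, eval_const, Finset.sum_boole, Nat.cast_id]
  rw [← Set.ncard_coe_finset]
  congr 1
  ext k
  simp

theorem eval_mul {x y : ℕ} (ha : ∀ k, a.eval N m (Function.update ρ 12 k) = x)
    (hb : ∀ k, b.eval N m (Function.update ρ 12 k) = y) (hx : x ≤ N) :
    (mul a b).eval N m ρ = x * y := by
  simp only [mul, eval_sum, eval_ite, holds_lt, ha, hb, eval_var, Function.update_self, eval_const]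
  rw [← Finset.sum_filter, Finset.sum_const, smul_eq_mul]
  congr 1
  rw [show (Finset.range N).filter (· < x) = Finset.range x by ext; simp; omega, Finset.card_range]

/-! ### Expressions for the isomorphism test -/

/-- The number of leading ones of the input. -/
def ones : Expr := count 10 (all 11 (imp (le (var 11) (var 10)) (load (var 11))))

/-- The length of the encoding of the first digraph. -/
def offset : Expr := add (add ones (const 1)) (mul ones ones)

/-- Adjacency in the disjoint union of the two digraphs. -/
def adj (a b : ℕ) : Expr :=
  ite (lt (var a) ones)
    (ite (lt (var b) ones) (load (add (add (add ones (const 1)) (mul (var a) ones)) (var b)))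
      (const 0))
    (ite (and (lt (var a) (add ones ones)) (and (le ones (var b)) (lt (var b) (add ones ones))))
      (load (add offset (add (add (add ones (const 1)) (sub (mul (var a) ones) (mul ones ones)))
        (sub (var b) ones))))
      (const 0))

/-- The colour of a vertex after the number of rounds in variable `1`. -/
def color (a : ℕ) : Expr := load (add (add (mul (var 1) size) size) (var a))

/-- The formula for two vertices to get the same colour in the next round. -/
def sameColor (a b : ℕ) : Expr :=
  and (eq (color a) (color b)) (and (eq (count 6 (adj a 6)) (count 6 (adj b 6)))
    (all 5 (eq (count 6 (and (adj 6 a) (eq (color 6) (var 5))))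
      (count 6 (and (adj 6 b) (eq (color 6) (var 5)))))))

/-- The entry with the address in variable `0` of the table of colours, which has the colours after
`r` rounds in the cells from `(r + 1) * N` on. The new colour of a vertex is the least vertex that
gets the same colour. -/
def newColor : Expr :=
  sum 1 (sum 2 (ite (eq (add (add (add (mul (var 1) size) size) size) (var 2)) (var 0))
    (count 3 (all 4 (imp (le (var 4) (var 3)) (not (sameColor 4 2)))))
    (const 0)))

/-- The final test. -/
def isomorphismTest : Expr :=
  ite (and (eq size (add offset offset)) (all 1 (imp (lt (var 1) ones)
    (ex 2 (and (lt (var 2) ones) (eq (load (add (add (mul size size) size) (var 1)))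
      (load (add (add (mul size size) size) (add ones (var 2)))))))))) (const 1) (const 0)

end Expr

/-! ### Meaning of the expressions on memory that holds an input -/

/-- The memory `m` starts with `n` ones and a zero. -/
structure HasOnes (N : ℕ) (m : ℕ → ℕ) (n : ℕ) : Prop where
  lt : n < N
  ne_zero : ∀ i < n, m i ≠ 0
  eq_zero : m n = 0

/-- The memory `m` contains the encodings of `X` and `Y`. -/
structure IsInput {n : ℕ} (N : ℕ) (m : ℕ → ℕ) (X Y : Digraph (Fin n)) : Prop
    extends HasOnes N m n where
  size_eq : N = n + 1 + n * n + (n + 1 + n * n)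
  left : ∀ a b : Fin n, m (n + 1 + a * n + b) ≠ 0 ↔ X.Adj a b
  right : ∀ a b : Fin n, m (n + 1 + n * n + (n + 1 + a * n + b)) ≠ 0 ↔ Y.Adj a b

theorem mul_add_lt_mul {n : ℕ} (a b : Fin n) : (a : ℕ) * n + b < n * n := by
  have := Nat.mul_le_mul_right n a.2
  have := b.2
  rw [Nat.succ_mul] at *
  omega

theorem HasOnes.congr {n N : ℕ} {m m' : ℕ → ℕ} (h : HasOnes N m n)
    (hm : ∀ i < N, m' i = m i) : HasOnes N m' n where
  lt := h.lt
  ne_zero i hi := by rw [hm i (hi.trans h.lt)]; exact h.ne_zero i hi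
  eq_zero := by rw [hm n h.lt]; exact h.eq_zero

theorem IsInput.congr {n N : ℕ} {m m' : ℕ → ℕ} {X Y : Digraph (Fin n)} (h : IsInput N m X Y)
    (hm : ∀ i < N, m' i = m i) : IsInput N m' X Y where
  toHasOnes := h.toHasOnes.congr hm
  size_eq := h.size_eq
  left a b := by
    have := mul_add_lt_mul a b
    rw [hm _ (by have := h.size_eq; omega), h.left]
  right a b := by
    have := mul_add_lt_mul a b
    rw [hm _ (by have := h.size_eq; omega), h.right]

namespace Expr

variable {N n : ℕ} {m ρ : ℕ → ℕ} {X Y : Digraph (Fin n)}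

theorem eval_ones (h : HasOnes N m n) : ones.eval N m ρ = n := by
  simp only [ones, eval_count, holds_all, holds_imp, holds_le, holds_load, eval_var,
    Function.update_self, ne_eq, Nat.reduceEqDiff, not_false_eq_true, Function.update_of_ne]
  rw [show {k | k < N ∧ ∀ j < N, j ≤ k → ¬ m j = 0} = (Finset.range n : Set ℕ) from ?_,
    Set.ncard_coe_finset, Finset.card_range]
  ext k
  simp only [Set.mem_ofPred_eq, Finset.coe_range, Set.mem_Iio]
  constructor
  · rintro ⟨-, hk⟩
    by_contra hnk
    exact hk n h.lt (by omega) h.eq_zero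
  · exact fun hk => ⟨hk.trans h.lt, fun j _ hjk => h.ne_zero j (by omega)⟩

theorem eval_mul_ones (h : HasOnes N m n) : (mul ones ones).eval N m ρ = n * n :=
  eval_mul (fun _ => eval_ones h) (fun _ => eval_ones h) h.lt.le

theorem eval_offset (h : HasOnes N m n) : offset.eval N m ρ = n + 1 + n * n := by
  simp [offset, eval_ones h, eval_mul_ones h]

theorem holds_ite {p a b : Expr} : (ite p a b).Holds N m ρ ↔
    (p.Holds N m ρ ∧ a.Holds N m ρ) ∨ (¬ p.Holds N m ρ ∧ b.Holds N m ρ) := by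
  by_cases h : p.Holds N m ρ
  · simp [h, Holds.eq_1 N m (ite p a b), eval_ite, Holds.eq_1 N m a]
  · simp [h, Holds.eq_1 N m (ite p a b), eval_ite, Holds.eq_1 N m b]

/-- The restriction on `a` avoids variable capture: `var a` occurs under the summation variable `12`
of `mul`. -/
theorem holds_adj (h : IsInput N m X Y) {a b : ℕ} (ha : a ≠ 12) :
    (adj a b).Holds N m ρ ↔ unionAdj X Y (ρ a) (ρ b) := by
  have h1 := h.toHasOnes
  have hN := h.size_eq
  have hmul : ρ a ≤ N → (mul (var a) ones).eval N m ρ = ρ a * n := fun hle =>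
    eval_mul (fun k => by simp [ha]) (fun _ => eval_ones h1) hle
  have h0 : ¬ (const 0).Holds N m ρ := by simp [Holds]
  simp only [adj, holds_ite, holds_lt, holds_and, holds_le, holds_load, eval_var, eval_add,
    eval_ones h1, eval_const, eval_offset h1, eval_sub, eval_mul_ones h1, h0, and_false, or_false]
  constructor
  · rintro (⟨hu, hv, hm⟩ | ⟨hu, ⟨hu', hv, hv'⟩, hm⟩)
    · rw [hmul (by omega)] at hm
      exact .inl ⟨⟨_, hu⟩, ⟨_, hv⟩, rfl, rfl, (h.left ⟨_, hu⟩ ⟨_, hv⟩).1 hm⟩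
    · rw [hmul (by omega), ← Nat.sub_mul] at hm
      exact .inr ⟨⟨ρ a - n, by omega⟩, ⟨ρ b - n, by omega⟩, by simp; omega, by simp; omega,
        (h.right _ _).1 hm⟩
  · rintro (⟨u, v, hu, hv, huv⟩ | ⟨u, v, hu, hv, huv⟩)
    · refine .inl ⟨hu ▸ u.2, hv ▸ v.2, ?_⟩
      rw [hmul (by omega), hu, hv]
      exact (h.left u v).2 huv
    · refine .inr ⟨by omega, ⟨by omega, by omega, by omega⟩, ?_⟩
      rw [hmul (by omega), ← Nat.sub_mul, hu, hv, Nat.add_sub_cancel_left, Nat.add_sub_cancel_left]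
      exact (h.right u v).2 huv

theorem eval_color {a : ℕ} (h : ρ 1 ≤ N) :
    (color a).eval N m ρ = m ((ρ 1 + 1) * N + ρ a) := by
  have : (mul (var 1) size).eval N m ρ = ρ 1 * N := eval_mul (fun k => by simp) (fun _ => rfl) h
  simp [color, this, Nat.succ_mul]

end Expr

/-- The vertices `x` and `y` get the same colour in the next round of colour refinement. -/
def SameColor (B : ℕ → ℕ → Prop) (N : ℕ) (c : ℕ → ℕ) (x y : ℕ) : Prop :=
  c x = c y ∧ {v | v < N ∧ B x v}.ncard = {v | v < N ∧ B y v}.ncard ∧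
    ∀ z < N, {w | w < N ∧ B w x ∧ c w = z}.ncard = {w | w < N ∧ B w y ∧ c w = z}.ncard

theorem SameColor.equivalence (B : ℕ → ℕ → Prop) (N : ℕ) (c : ℕ → ℕ) :
    Equivalence (SameColor B N c) where
  refl _ := ⟨rfl, rfl, fun _ _ => rfl⟩
  symm h := ⟨h.1.symm, h.2.1.symm, fun z hz => (h.2.2 z hz).symm⟩
  trans h h' := ⟨h.1.trans h'.1, h.2.1.trans h'.2.1, fun z hz => (h.2.2 z hz).trans (h'.2.2 z hz)⟩

theorem SameColor.congr {B : ℕ → ℕ → Prop} {N : ℕ} {c c' : ℕ → ℕ} (hc : ∀ x < N, c x = c' x)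
    {x y : ℕ} (hx : x < N) (hy : y < N) : SameColor B N c x y ↔ SameColor B N c' x y := by
  have : ∀ x z, {w | w < N ∧ B w x ∧ c w = z} = {w | w < N ∧ B w x ∧ c' w = z} := fun x z => by
    ext w
    exact and_congr_right fun hw => by rw [hc w hw]
  simp only [SameColor, hc x hx, hc y hy, this]

/-- The least number below `N` that satisfies `P`. -/
noncomputable def leastBelow (N : ℕ) (P : ℕ → Prop) : ℕ :=
  {y | y < N ∧ ∀ y' < N, y' ≤ y → ¬ P y'}.ncard

theorem leastBelow_congr {N : ℕ} {P Q : ℕ → Prop} (h : ∀ y < N, P y ↔ Q y) :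
    leastBelow N P = leastBelow N Q := by
  simp only [leastBelow]
  congr 1
  ext y
  exact and_congr_right fun _ => forall₂_congr fun y' hy' => by rw [h y' hy']

theorem leastBelow_spec {N : ℕ} {P : ℕ → Prop} {x : ℕ} (hx : x < N) (h : P x) :
    leastBelow N P < N ∧ P (leastBelow N P) := by
  classical
  have hex : ∃ x, P x := ⟨x, h⟩
  have : leastBelow N P = Nat.find hex := by
    rw [leastBelow, show {y | y < N ∧ ∀ y' < N, y' ≤ y → ¬ P y'}
      = (Finset.range (Nat.find hex) : Set ℕ) from ?_, Set.ncard_coe_finset, Finset.card_range]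
    have hN : Nat.find hex < N := (Nat.find_min' hex h).trans_lt hx
    ext y
    simp only [Set.mem_ofPred_eq, Finset.coe_range, Set.mem_Iio, Nat.lt_find_iff]
    exact ⟨fun hy y' hy' => hy.2 y' (by omega) hy', fun hy =>
      ⟨((Nat.lt_find_iff hex y).2 hy).trans hN, fun y' _ hy' => hy y' hy'⟩⟩
  rw [this]
  exact ⟨(Nat.find_min' hex h).trans_lt hx, Nat.find_spec hex⟩

/-- The least member of an equivalence class is a canonical name for it that is again below `N`;
hence new colours stay in range. -/
theorem leastBelow_eq_iff {N : ℕ} {S : ℕ → ℕ → Prop} (hS : Equivalence S) {x y : ℕ} (hx : x < N)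
    (hy : y < N) : leastBelow N (S · x) = leastBelow N (S · y) ↔ S x y := by
  refine ⟨fun h => ?_, fun h => leastBelow_congr fun z _ =>
    ⟨fun hz => hS.trans hz h, fun hz => hS.trans hz (hS.symm h)⟩⟩
  have h1 := (leastBelow_spec (P := (S · x)) hx (hS.refl x)).2
  have h2 := (leastBelow_spec (P := (S · y)) hy (hS.refl y)).2
  rw [← h] at h2
  exact hS.trans (hS.symm h1) h2

namespace Expr

variable {N n : ℕ} {m ρ : ℕ → ℕ} {X Y : Digraph (Fin n)}

theorem holds_sameColor (h : IsInput N m X Y) (hρ : ρ 1 ≤ N) {a b : ℕ} (ha : a < 5) (hb : b < 5) :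
    (sameColor a b).Holds N m ρ ↔
      SameColor (unionAdj X Y) N (fun x => m ((ρ 1 + 1) * N + x)) (ρ a) (ρ b) := by
  have ha5 : a ≠ 5 := by omega
  have ha6 : a ≠ 6 := by omega
  have ha12 : a ≠ 12 := by omega
  have hb5 : b ≠ 5 := by omega
  have hb6 : b ≠ 6 := by omega
  have hb12 : b ≠ 12 := by omega
  simp [sameColor, SameColor, eval_color, hρ, holds_adj h, ha5, ha6, ha12, hb5, hb6, hb12]

theorem eval_newColor (h : IsInput N m X Y) {r x : ℕ} (hr : r < N) (hx : x < N)
    (hρ : ρ 0 = (r + 1 + 1) * N + x) : newColor.eval N m ρ =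
      leastBelow N (SameColor (unionAdj X Y) N (fun x => m ((r + 1) * N + x)) · x) := by
  classical
  have hmul : ∀ r' ∈ Finset.range N, ∀ x',
      (mul (var 1) size).eval N m (Function.update (Function.update ρ 1 r') 2 x') = r' * N :=
    fun r' hr' x' => eval_mul (fun k => by simp) (fun _ => rfl)
      (by simpa using (Finset.mem_range.1 hr').le)
  -- Uniqueness of division with remainder by `N`: round and vertex are recovered from the address
  -- by a double sum with exactly one nonvanishing term, without a division instruction.
  have huniq : ∀ r' x', x' < N → (r' * N + N + N + x' = (r + 1 + 1) * N + x ↔ r' = r ∧ x' = x) := by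
    intro r' x' hx'
    constructor
    · intro h
      have h1 : N * r' + x' = N * r + x := by linarith
      have h2 := congrArg (· / N) h1
      have h3 := congrArg (· % N) h1
      simp only [Nat.mul_add_div (Nat.zero_lt_of_lt hx), Nat.mul_add_mod, Nat.div_eq_of_lt hx,
        Nat.div_eq_of_lt hx', Nat.mod_eq_of_lt hx, Nat.mod_eq_of_lt hx', add_zero] at h2 h3
      exact ⟨h2, h3⟩
    · rintro ⟨rfl, rfl⟩; ring
  rw [newColor, eval_sum, Finset.sum_eq_single_of_mem r (Finset.mem_range.2 hr), eval_sum,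
    Finset.sum_eq_single_of_mem x (Finset.mem_range.2 hx)]
  · rw [eval_ite, if_pos]
    · simp [holds_sameColor h, hr.le, leastBelow]
    · simp [hmul r (Finset.mem_range.2 hr), hρ, Nat.succ_mul]
  · intro x' hx' hne
    rw [eval_ite, if_neg, eval_const]
    simp [hmul r (Finset.mem_range.2 hr), hρ, huniq r x' (Finset.mem_range.1 hx'), hne]
  · intro r' hr' hne
    rw [eval_sum]
    refine Finset.sum_eq_zero fun x' hx' => ?_
    rw [eval_ite, if_neg, eval_const]
    simp [hmul r' hr', hρ, huniq r' x' (Finset.mem_range.1 hx'), hne]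

open Classical in
theorem eval_isomorphismTest (h : HasOnes N m n) : isomorphismTest.eval N m ρ =
    if N = n + 1 + n * n + (n + 1 + n * n) ∧
      ∀ u < n, ∃ v < n, m ((N + 1) * N + u) = m ((N + 1) * N + (n + v)) then 1 else 0 := by
  have hmul : ∀ ρ, (mul size size).eval N m ρ = N * N := fun ρ =>
    eval_mul (fun _ => rfl) (fun _ => rfl) le_rfl
  rw [isomorphismTest, eval_ite]
  refine if_congr ?_ rfl rfl
  simp only [holds_and, holds_eq, holds_all, holds_imp, holds_lt, holds_ex, eval_size, eval_add,
    eval_offset h, eval_ones h, eval_load, hmul, eval_var, Function.update_self, ne_eq,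
    OfNat.one_ne_ofNat, not_false_eq_true, Function.update_of_ne, Nat.succ_mul]
  refine and_congr_right fun _ => ⟨fun H u hu => ?_, fun H u _ hu => ?_⟩
  · obtain ⟨v, -, hv⟩ := H u (hu.trans h.lt) hu
    exact ⟨v, hv⟩
  · obtain ⟨v, hv⟩ := H u hu
    exact ⟨v, hv.1.trans h.lt, hv⟩

end Expr

/-- Cells are written in increasing order, so an entry, once written, is final; the input below `2 *
N` is never touched. -/
theorem table_of_lt {E : Expr} {N : ℕ} {m : ℕ → ℕ} {k l a : ℕ} (hkl : k ≤ l)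
    (ha : a < N + N + k) : table E N m l a = table E N m k a := by
  induction l, hkl using Nat.le_induction with
  | base => rfl
  | succ l hl ih => rw [table, Function.update_of_ne (by omega), ih]

theorem table_add {E : Expr} {N : ℕ} {m : ℕ → ℕ} {k l : ℕ} (hkl : k < l) :
    table E N m l (N + N + k) =
      E.eval N (table E N m k) (Function.update (fun _ => 0) 0 (N + N + k)) := by
  rw [table_of_lt (k := k + 1) hkl (by omega), table, Function.update_self]

/-- The table contains the colours of all rounds of colour refinement. -/
theorem isColorRefinement_table {n N : ℕ} {m : ℕ → ℕ} {X Y : Digraph (Fin n)}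
    (h : IsInput N m X Y) (h0 : ∀ x < N, m (N + x) = 0) :
    IsColorRefinement (unionAdj X Y) N
      (fun r x => table Expr.newColor N m (N * N) ((r + 1) * N + x)) := by
  set c := fun r x => table Expr.newColor N m (N * N) ((r + 1) * N + x) with hc
  have hzero : ∀ x < N, c 0 x = 0 := fun x hx => by
    -- Round `0` occupies the cells `N, …, 2 * N - 1`, zero from the start; this is why the table
    -- begins at `2 * N`.
    simp only [hc, zero_add, one_mul]
    rw [table_of_lt (Nat.zero_le _) (by omega), table, h0 x hx]
  have hsucc : ∀ r < N, ∀ x < N,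
      c (r + 1) x = leastBelow N (SameColor (unionAdj X Y) N (c r) · x) := by
    intro r hr x hx
    have hk : r * N + x < N * N := by
      have := Nat.mul_le_mul_right N (Nat.succ_le_of_lt hr)
      rw [Nat.succ_mul] at this
      omega
    have hadd : (r + 1 + 1) * N + x = N + N + (r * N + x) := by ring
    simp only [hc]
    rw [hadd, table_add hk, Expr.eval_newColor (h.congr fun i hi => ?_) hr hx (by simp [hadd])]
    · refine leastBelow_congr fun y hy => SameColor.congr (fun z hz => ?_) hy hx
      -- The whole row of round `r` lies before the cell being written, so the partially filled
      -- table already has its final values there.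
      rw [table_of_lt hk.le]
      rw [Nat.succ_mul]
      omega
    · rw [table_of_lt (Nat.zero_le _) (by omega), table]
  refine ⟨hzero, fun r hr x hx => ?_, fun r hr x hx y hy => ?_⟩
  · rcases r with _ | r
    · rw [hzero x hx]; omega
    · rw [hsucc r hr x hx]
      exact (leastBelow_spec (P := (SameColor _ _ _ · x)) hx ((SameColor.equivalence _ _ _).refl x)).1
  · rw [hsucc r hr x hx, hsucc r hr y hy]
    exact leastBelow_eq_iff (SameColor.equivalence _ _ _) hx hy

end RAM

/-! ### Encodings -/

namespace Digraph

variable {n : ℕ} (X : Digraph (Fin n))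

open Classical in
theorem encode_eq : X.encode = List.replicate n true ++ false ::
    List.ofFn fun k : Fin (n * n) => decide (X.Adj k.divNat k.modNat) := by
  rw [encode, List.ofFn_mul, List.flatMap_def, List.ofFn_eq_map]
  congr 4
  funext a
  rw [List.ofFn_eq_map]
  refine List.map_congr_left fun b _ => ?_
  have hb := b.2
  congr 3 <;> ext
  · simp [Fin.divNat, Nat.mul_add_div (Nat.zero_lt_of_lt hb), mul_comm _ n, Nat.div_eq_of_lt hb]
  · simp [Fin.modNat, mul_comm _ n, Nat.mod_eq_of_lt hb]

theorem length_encode : X.encode.length = n + 1 + n * n := by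
  rw [encode_eq]; simp; ring

theorem getD_encode_of_lt {i : ℕ} (hi : i < n) : X.encode.getD i false = true := by
  rw [encode_eq, List.getD_append _ _ _ _ (by simpa using hi)]
  simp [hi]

theorem getD_encode_self : X.encode.getD n false = false := by
  rw [encode_eq, List.getD_append_right _ _ _ _ (by simp)]
  simp

open Classical in
theorem getD_encode_add (a b : Fin n) :
    X.encode.getD (n + 1 + a * n + b) false = decide (X.Adj a b) := by
  have hab := RAM.mul_add_lt_mul a b
  have hb := b.2
  rw [encode_eq, List.getD_append_right _ _ _ _ (by simp; omega), List.length_replicate,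
    show n + 1 + a * n + b - n = (a * n + b) + 1 by omega, List.getD_cons_succ,
    List.getD_eq_getElem _ _ (by simpa using hab), List.getElem_ofFn]
  congr 2 <;> ext
  · simp [Fin.divNat, Nat.mul_add_div (Nat.zero_lt_of_lt hb), mul_comm _ n, Nat.div_eq_of_lt hb]
  · simp [Fin.modNat, mul_comm _ n, Nat.mod_eq_of_lt hb]

end Digraph

namespace RAM

theorem hasOnes_init {n₁ n₂ : ℕ} (X₁ : Digraph (Fin n₁)) (X₂ : Digraph (Fin n₂)) :
    HasOnes (X₁.encode ++ X₂.encode).length (init (X₁.encode ++ X₂.encode)).mem n₁ := by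
  have hl := X₁.length_encode
  refine ⟨by rw [List.length_append]; omega, fun i hi => ?_, ?_⟩
  · simp only [init]
    rw [List.getD_append _ _ _ _ (by omega), X₁.getD_encode_of_lt hi]
    simp
  · simp only [init]
    rw [List.getD_append _ _ _ _ (by omega), X₁.getD_encode_self]
    rfl

theorem isInput_init {n : ℕ} (X Y : Digraph (Fin n)) :
    IsInput (X.encode ++ Y.encode).length (init (X.encode ++ Y.encode)).mem X Y where
  toHasOnes := hasOnes_init X Y
  size_eq := by rw [List.length_append, X.length_encode, Y.length_encode]
  left a b := by
    have := mul_add_lt_mul a b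
    simp only [init]
    rw [List.getD_append _ _ _ _ (by rw [X.length_encode]; omega), X.getD_encode_add]
    simp
  right a b := by
    simp only [init]
    rw [← X.length_encode, List.getD_append_right _ _ _ _ (by omega), Nat.add_sub_cancel_left,
      Y.getD_encode_add]
    simp

end RAM

/-- Isomorphism of directed power graphs of finite nilpotent groups, given only as digraphs, is
decidable in polynomial time. -/
theorem mainTheorem1 :
    ∃ (P : RAM.Prog) (p : Polynomial ℕ),
      ∀ (n₁ n₂ : ℕ) (X₁ : Digraph (Fin n₁)) (X₂ : Digraph (Fin n₂)),
        IsNilpotentDPow X₁ → IsNilpotentDPow X₂ →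
          (X₁.Isomorphic X₂ →
            RAM.OutputsWithin P (X₁.encode ++ X₂.encode) true
              (p.eval (X₁.encode ++ X₂.encode).length)) ∧
          (¬ X₁.Isomorphic X₂ →
            RAM.OutputsWithin P (X₁.encode ++ X₂.encode) false
              (p.eval (X₁.encode ++ X₂.encode).length)) := by
  classical
  obtain ⟨P, p, hP⟩ := RAM.exists_prog_table RAM.Expr.newColor RAM.Expr.isomorphismTest
  refine ⟨P, p, fun n₁ n₂ X₁ X₂ h₁ h₂ => ?_⟩
  suffices h : RAM.OutputsWithin P (X₁.encode ++ X₂.encode) (decide (X₁.Isomorphic X₂))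
      (p.eval (X₁.encode ++ X₂.encode).length) from
    ⟨fun hi => by simpa [hi] using h, fun hi => by simpa [hi] using h⟩
  obtain ⟨ρ, t, s, hE, ht, hs⟩ := hP (X₁.encode ++ X₂.encode)
  refine ⟨t, s, hE, ht, hs.trans ?_⟩
  set N := (X₁.encode ++ X₂.encode).length with hN
  set m := (RAM.init (X₁.encode ++ X₂.encode)).mem with hm
  have hNn : N = n₁ + 1 + n₁ * n₁ + (n₂ + 1 + n₂ * n₂) := by
    rw [hN, List.length_append, X₁.length_encode, X₂.length_encode]
  rw [RAM.Expr.eval_isomorphismTest ((RAM.hasOnes_init X₁ X₂).congr fun i hi => by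
    rw [RAM.table_of_lt (Nat.zero_le _) (by omega), RAM.table])]
  by_cases hn : n₁ = n₂
  · subst hn
    have hc := RAM.isColorRefinement_table (RAM.isInput_init X₁ X₂) fun x _ => by
      simp only [RAM.init]
      rw [List.getD_eq_default _ _ (by omega)]
      rfl
    have hle : n₁ + n₁ ≤ N := by omega
    by_cases hi : X₁.Isomorphic X₂
    · rw [if_pos ⟨hNn, hc.of_isomorphic hle hi⟩]
      simp [hi]
    · rw [if_neg fun h => hi (hc.isomorphic hle h₁ h₂ h.2)]
      simp [hi]
  · have hi : ¬ X₁.Isomorphic X₂ := fun ⟨e⟩ => hn (by simpa using Fintype.card_congr e.toEquiv)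
    rw [if_neg]
    · simp [hi]
    -- The test on the length fails, because `n + 1 + n * n` is strictly increasing in `n`.
    · rintro ⟨h, -⟩
      rcases lt_or_gt_of_ne hn with h' | h' <;> nlinarith
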